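/- Let $k$ be a field, $A$ a finite-dimensional (associative, unital) $k$-algebra, $e\in A$ an idempotent, and $AeA$ the two-sided ideal generated by $e$. For a finite-dimensional algebra $B$, let $\operatorname{ind} B$ be the class of finitely generated indecomposable right $B$-modules. A path of length $s\ge 0$ from $M$ to $N$ is a sequence $M=X_0\xrightarrow{f_1}X_1\to\cdots\xrightarrow{f_s}X_s=N$ with all $X_i\in\operatorname{ind}B$ and every $f_i$ a nonzero non-isomorphism. Put $$\mathcal L_B=\{X\in\operatorname{ind}B : \operatorname{pd}_B W\le 1\text{ for every path from some } W\text{ to }X\},$$ $$\mathcal R_B=\{Y\in\operatorname{ind}B : \operatorname{id}_B W\le 1\text{ for every path from }Y\text{ to some }W\}.$$ A subclass of $\operatorname{ind}B$ is cofinite if, up to isomorphism, only finitely many modules in $\operatorname{ind}B$ lie outside it. The algebra $B$ is called - laura if $\mathcal L_B\cup\mathcal R_B$ is cofinite in $\operatorname{ind}B$; - right glued (resp. left glued) if $\mathcal L_B$ (resp. $\mathcal R_B$) is cofinite in $\operatorname{ind}B$; - weakly shod if there is a bound on the lengths of all paths from an indecomposable injective module to an indecomposable projective module; - shod if every $M\in\operatorname{ind}B$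 satisfies $\operatorname{pd}_B M\le 1$ or $\operatorname{id}_B M\le 1$. Then: 1. If $A$ is laura, then so is $A/AeA$. 2. If $A$ is right glued, then so is $A/AeA$; if $A$ is left glued, then so is $A/AeA$. 3. If $A$ is weakly shod, then so is $A/AeA$. 4. If $A$ is shod, then so is $A/AeA$. -/

import Mathlib

open CategoryTheory

universe u

namespace IdempotentQuotient

/-- Right `A`-modules, that is, left modules over the opposite ring. Every finitely generated
right `A`-module is isomorphic to a quotient of some `A ^ n`, hence to one in the universe of `A`. -/
abbrev RightMod (A : Type u) [Ring A] := ModuleCat.{u} Aᵐᵒᵖ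

/-- The finitely generated indecomposable right `A`-modules. -/
def ind (A : Type u) [Ring A] : Set (RightMod A) :=
  {X | Module.Finite Aᵐᵒᵖ X ∧ Indecomposable X}

/-- `IsPath M N s`: there is a path `M = X₀ ⟶ X₁ ⟶ ⋯ ⟶ Xₛ = N` of length `s` in `ind A`, each
arrow being a nonzero non-isomorphism. The trivial path of length `0` is allowed. -/
inductive IsPath {A : Type u} [Ring A] : RightMod A → RightMod A → ℕ → Prop
  | nil {X : RightMod A} (hX : X ∈ ind A) : IsPath X X 0
  | cons {X Y Z : RightMod A} {s : ℕ} (hX : X ∈ ind A) (f : X ⟶ Y) (hf : f ≠ 0)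
      (hf' : ¬ IsIso f) (p : IsPath Y Z s) : IsPath X Z (s + 1)

/-- The left part `𝓛_A`: all predecessors have projective dimension at most one. -/
def leftPart (A : Type u) [Ring A] : Set (RightMod A) :=
  {X | X ∈ ind A ∧ ∀ (W : RightMod A) (s : ℕ), IsPath W X s → HasProjectiveDimensionLE W 1}

/-- The right part `𝓡_A`: all successors have injective dimension at most one. -/
def rightPart (A : Type u) [Ring A] : Set (RightMod A) :=
  {Y | Y ∈ ind A ∧ ∀ (W : RightMod A) (s : ℕ), IsPath Y W s → HasInjectiveDimensionLE W 1}

/-- `S` is cofinite in `ind A`: the modules in `ind A` outside `S` form only finitely many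
isomorphism classes. -/
def CofiniteInInd (A : Type u) [Ring A] (S : Set (RightMod A)) : Prop :=
  Set.Finite ((fun X : RightMod A => Quotient.mk (isIsomorphicSetoid (RightMod A)) X) ''
    (ind A \ S))

/-- `𝓛_A ∪ 𝓡_A` is cofinite in `ind A`. -/
def IsLaura (A : Type u) [Ring A] : Prop :=
  CofiniteInInd A (leftPart A ∪ rightPart A)

/-- `𝓛_A` is cofinite in `ind A`. -/
def IsRightGlued (A : Type u) [Ring A] : Prop :=
  CofiniteInInd A (leftPart A)

/-- `𝓡_A` is cofinite in `ind A`. -/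
def IsLeftGlued (A : Type u) [Ring A] : Prop :=
  CofiniteInInd A (rightPart A)

/-- The lengths of the paths from indecomposable injective to indecomposable projective modules
are bounded. -/
def IsWeaklyShod (A : Type u) [Ring A] : Prop :=
  ∃ l : ℕ, ∀ (I P : RightMod A) (s : ℕ), Injective I → Projective P → IsPath I P s → s ≤ l

/-- Every indecomposable module has projective or injective dimension at most one. -/
def IsShod (A : Type u) [Ring A] : Prop :=
  ∀ M ∈ ind A, HasProjectiveDimensionLE M 1 ∨ HasInjectiveDimensionLE M 1

/-- The quotient `A / AeA` by the two-sided ideal generated by `e`. -/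
abbrev quotByIdeal {A : Type u} [Ring A] (e : A) : Type u :=
  (TwoSidedIdeal.span {e}).ringCon.Quotient

end IdempotentQuotient

/-! Put `J = AeA` and `B = A/J`. Everything rests on `J = J²`, which holds because `e` is
idempotent. Restriction of scalars from `B` to `A` is fully faithful and preserves finite generation
and indecomposability, so it carries paths to paths of the same length and is injective on
isomorphism classes. Since `J = J²`, a `B`-module of projective (injective) dimension at most one
over `A` has the same property over `B` (`hasProjectiveDimensionLE_one_of_restrictScalars`,
`hasInjectiveDimensionLE_one_of_restrictScalars`). Hence a `B`-module whose restriction lies in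
`leftPart A` or `rightPart A` lies in the corresponding part for `B`. The laura, glued and shod
cases follow at once.

The weakly shod case needs more, since an injective or projective `B`-module need not be so over
`A`. Take a path of length `m` in `ind B` from an injective to a projective, and let `r` be the
number of simple `B`-modules. A path from an injective into the left part has length less than `r`
(`length_lt_rank`), and dually for the right part. If `m > 2r`, the term at position `r` therefore
restricts outside `leftPart A`, and the term at position `m - r` restricts outside `rightPart A`.
Over `A` the former has an injective predecessor and the latter a projective successor
(`exists_injective_path` and its dual), so the stretch between them sits inside an
injective-to-projective path over `A`, whose length is bounded by hypothesis.

For `length_lt_rank`: modules of the left part hit by an injective are Ext-injective there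
(`Left.extZero`), and nonzero maps out of them within the left part compose to nonzero maps. So a
path from an injective has no nonzero backward maps, its Euler form is triangular with nonzero
diagonal, and its terms are independent in a Grothendieck group of rank `r` (`card_le_rank`). The
argument is run for an abstract self-dual `FiniteTheory`, so that statements on the right part come
from the opposite category. -/

namespace IdempotentQuotient

open Limits Relation

/-! ### Short exact sequences, splittings and indecomposability in an abelian category. -/

section Abelian

variable {C : Type*} [Category C] [Abelian C]

/-- A self-dual form of indecomposability: `X` is nonzero without nontrivial idempotents. -/
def IsIndec (X : C) : Prop :=
  ¬ IsZero X ∧ ∀ p : X ⟶ X, p ≫ p = p → p = 0 ∨ p = 𝟙 X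

lemma exists_lift {K Q X : C} {i : K ⟶ Q} {p : Q ⟶ X} {w : i ≫ p = 0}
    (h : (ShortComplex.mk i p w).ShortExact) {T : C} (x : T ⟶ Q) (hx : x ≫ p = 0) :
    ∃ l : T ⟶ K, l ≫ i = x := by
  have := h.mono_f
  exact ⟨h.exact.lift x hx, h.exact.lift_f x hx⟩

lemma exists_desc {K Q X : C} {i : K ⟶ Q} {p : Q ⟶ X} {w : i ≫ p = 0}
    (h : (ShortComplex.mk i p w).ShortExact) {T : C} (x : Q ⟶ T) (hx : i ≫ x = 0) :
    ∃ l : X ⟶ T, p ≫ l = x := by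
  have := h.epi_g
  exact ⟨h.exact.desc x hx, h.exact.g_desc x hx⟩

lemma shortExact_of_lift {K Q X : C} {i : K ⟶ Q} {p : Q ⟶ X} (w : i ≫ p = 0) [Mono i] [Epi p]
    (h : ∀ {T : C} (x : T ⟶ Q), x ≫ p = 0 → ∃ l : T ⟶ K, l ≫ i = x) :
    (ShortComplex.mk i p w).ShortExact :=
  .mk' (ShortComplex.exact_of_f_is_kernel _ (KernelFork.IsLimit.ofι' i w
    fun x hx => ⟨(h x hx).choose, (h x hx).choose_spec⟩)) ‹_› ‹_›

lemma shortExact_of_desc {K Q X : C} {i : K ⟶ Q} {p : Q ⟶ X} (w : i ≫ p = 0) [Mono i] [Epi p]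
    (h : ∀ {T : C} (x : Q ⟶ T), i ≫ x = 0 → ∃ l : X ⟶ T, p ≫ l = x) :
    (ShortComplex.mk i p w).ShortExact :=
  .mk' (ShortComplex.exact_of_g_is_cokernel _ (CokernelCofork.IsColimit.ofπ' p w
    fun x hx => ⟨(h x hx).choose, (h x hx).choose_spec⟩)) ‹_› ‹_›

lemma shortExact_kernel {Q X : C} (p : Q ⟶ X) [Epi p] :
    (ShortComplex.mk (kernel.ι p) p (kernel.condition p)).ShortExact :=
  shortExact_of_lift _ fun x hx => ⟨kernel.lift p x hx, kernel.lift_ι p x hx⟩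

lemma shortExact_cokernel {K Q : C} (i : K ⟶ Q) [Mono i] :
    (ShortComplex.mk i (cokernel.π i) (cokernel.condition i)).ShortExact :=
  shortExact_of_desc _ fun x hx => ⟨cokernel.desc i x hx, cokernel.π_desc i x hx⟩

lemma exists_retraction {K Q X : C} {i : K ⟶ Q} {p : Q ⟶ X} {w : i ≫ p = 0}
    (h : (ShortComplex.mk i p w).ShortExact) (s : X ⟶ Q) (hs : s ≫ p = 𝟙 X) :
    ∃ r : Q ⟶ K, i ≫ r = 𝟙 K := by
  obtain ⟨l, hl⟩ := exists_lift h (𝟙 Q - p ≫ s) (by simp [hs])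
  have := h.mono_f
  refine ⟨l, ?_⟩
  rw [← cancel_mono i, Category.assoc, hl]
  simp [reassoc_of% w]

lemma exists_section {K Q X : C} {i : K ⟶ Q} {p : Q ⟶ X} {w : i ≫ p = 0}
    (h : (ShortComplex.mk i p w).ShortExact) (r : Q ⟶ K) (hr : i ≫ r = 𝟙 K) :
    ∃ s : X ⟶ Q, s ≫ p = 𝟙 X := by
  obtain ⟨l, hl⟩ := exists_desc h (𝟙 Q - r ≫ i) (by simp [reassoc_of% hr])
  have := h.epi_g
  refine ⟨l, ?_⟩
  rw [← cancel_epi p, reassoc_of% hl]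
  simp [w]

/-- The pushout of a short exact sequence along a morphism out of its left term. -/
lemma exists_pushout {K Q X : C} {i : K ⟶ Q} {p : Q ⟶ X} {w : i ≫ p = 0}
    (h : (ShortComplex.mk i p w).ShortExact) {Y : C} (g : K ⟶ Y) :
    ∃ (E : C) (j : Y ⟶ E) (q : Q ⟶ E) (p' : E ⟶ X) (w' : j ≫ p' = 0),
      (ShortComplex.mk j p' w').ShortExact ∧ i ≫ q = g ≫ j := by
  have : Mono i := h.mono_f
  have : Epi p := h.epi_g
  have wg : i ≫ p = g ≫ (0 : Y ⟶ X) := by rw [w, comp_zero]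
  have hl : pushout.inl i g ≫ pushout.desc p 0 wg = p := pushout.inl_desc p 0 wg
  have hr : pushout.inr i g ≫ pushout.desc p 0 wg = 0 := pushout.inr_desc p 0 wg
  have : Epi (pushout.desc p 0 wg) := epi_of_epi_fac hl
  refine ⟨pushout i g, pushout.inr i g, pushout.inl i g, _, hr, ?_, pushout.condition⟩
  refine shortExact_of_desc _ fun x hx => ?_
  obtain ⟨l, h'⟩ := exists_desc h (pushout.inl i g ≫ x) (by
    rw [pushout.condition_assoc, hx, comp_zero])
  refine ⟨l, pushout.hom_ext ?_ ?_⟩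
  · rw [reassoc_of% hl, h']
  · rw [reassoc_of% hr, hx, zero_comp]

/-- The idempotent `r ≫ s` of `Y` is `0` or `1`, and `0` would force `Z` to vanish. -/
lemma IsIndec.isIso_of_retract {Y Z : C} (hY : IsIndec Y) (hZ : ¬ IsZero Z) {s : Z ⟶ Y}
    {r : Y ⟶ Z} (h : s ≫ r = 𝟙 Z) : IsIso s ∧ IsIso r := by
  rcases hY.2 (r ≫ s) (by simp [reassoc_of% h]) with h0 | h1
  · exfalso
    apply hZ
    rw [IsZero.iff_id_eq_zero]
    calc 𝟙 Z = s ≫ (r ≫ s) ≫ r := by simp [h]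
      _ = 0 := by simp [h0]
  · exact ⟨⟨r, h, h1⟩, ⟨s, h1, h⟩⟩

lemma IsIndec.id_ne_zero {X : C} (hX : IsIndec X) : 𝟙 X ≠ 0 := fun h =>
  hX.1 ((IsZero.iff_id_eq_zero X).2 h)

end Abelian

/-- The formal properties of the finitely generated modules over a finite-dimensional algebra, as a
class of objects of the category of all modules. They are self-dual. -/
structure FiniteTheory (C : Type*) [Category C] [Abelian C] where
  fin : C → Prop
  of_mono {X Y : C} (f : X ⟶ Y) : Mono f → fin Y → fin X
  of_epi {X Y : C} (f : X ⟶ Y) : Epi f → fin X → fin Y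
  of_ext {S : ShortComplex C} : S.ShortExact → fin S.X₁ → fin S.X₃ → fin S.X₂
  len : C → ℕ
  len_add {S : ShortComplex C} : S.ShortExact → fin S.X₂ → len S.X₂ = len S.X₁ + len S.X₃
  isZero_of_len {X : C} : fin X → len X = 0 → IsZero X
  exists_projective {X : C} : fin X → ∃ (Q : C) (p : Q ⟶ X), fin Q ∧ Projective Q ∧ Epi p
  exists_injective {X : C} : fin X → ∃ (J : C) (i : X ⟶ J), fin J ∧ Injective J ∧ Mono i
  hom : C → C → ℕ
  hom_eq_zero_iff {X Y : C} : fin X → fin Y → (hom X Y = 0 ↔ ∀ f : X ⟶ Y, f = 0)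
  hom_add_left {S : ShortComplex C} {Y : C} : S.ShortExact → fin S.X₂ → fin Y →
    (∀ g : S.X₁ ⟶ Y, ∃ h, S.f ≫ h = g) → hom S.X₂ Y = hom S.X₁ Y + hom S.X₃ Y
  hom_add_right {S : ShortComplex C} {Y : C} : S.ShortExact → fin S.X₂ → fin Y →
    (∀ g : Y ⟶ S.X₃, ∃ h, h ≫ S.g = g) → hom Y S.X₂ = hom Y S.X₁ + hom Y S.X₃
  exists_left_inv {X : C} : fin X → ∀ f : X ⟶ X, (∀ g : X ⟶ X, g ≫ f = 0 → g = 0) →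
    ∃ g : X ⟶ X, g ≫ f = 𝟙 X
  exists_right_inv {X : C} : fin X → ∀ f : X ⟶ X, (∀ g : X ⟶ X, f ≫ g = 0 → g = 0) →
    ∃ g : X ⟶ X, f ≫ g = 𝟙 X
  rank : ℕ
  simple : Fin rank → C
  simple_ne (i : Fin rank) : ¬ IsZero (simple i)
  exists_mono {X : C} : fin X → ¬ IsZero X → ∃ (i : Fin rank) (f : simple i ⟶ X), Mono f
  exists_epi {X : C} : fin X → ¬ IsZero X → ∃ (i : Fin rank) (f : X ⟶ simple i), Epi f

namespace FiniteTheory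

variable {C : Type*} [Category C] [Abelian C] (T : FiniteTheory C)

/-- The indecomposable finite objects. -/
def Ind (X : C) : Prop := T.fin X ∧ IsIndec X

/-- One arrow of a path. -/
def Step (X Y : C) : Prop := T.Ind X ∧ T.Ind Y ∧ ∃ f : X ⟶ Y, f ≠ 0 ∧ ¬ IsIso f

/-- Projective dimension at most one, for finite objects. -/
def PdLEOne (X : C) : Prop :=
  ∀ ⦃K Q : C⦄ (i : K ⟶ Q) (p : Q ⟶ X) (w : i ≫ p = 0), (ShortComplex.mk i p w).ShortExact →
    T.fin Q → Projective Q → Projective K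

/-- Injective dimension at most one, for finite objects. -/
def IdLEOne (X : C) : Prop :=
  ∀ ⦃Q K : C⦄ (i : X ⟶ Q) (p : Q ⟶ K) (w : i ≫ p = 0), (ShortComplex.mk i p w).ShortExact →
    T.fin Q → Injective Q → Injective K

/-- The left part. -/
def Left (X : C) : Prop := T.Ind X ∧ ∀ W, ReflTransGen T.Step W X → T.PdLEOne W

/-- The right part. -/
def Right (X : C) : Prop := T.Ind X ∧ ∀ W, ReflTransGen T.Step X W → T.IdLEOne W

/-- The vanishing of `Ext¹(F, Y)`, phrased with finite projective presentations of `F`. -/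
def ExtZero (F Y : C) : Prop :=
  ∀ ⦃K Q : C⦄ (i : K ⟶ Q) (p : Q ⟶ F) (w : i ≫ p = 0), (ShortComplex.mk i p w).ShortExact →
    T.fin Q → Projective Q → ∀ g : K ⟶ Y, ∃ h : Q ⟶ Y, i ≫ h = g

/-- There is a nonzero morphism from a finite injective object. -/
def Hit (Y : C) : Prop := ∃ (J : C) (u : J ⟶ Y), T.fin J ∧ Injective J ∧ u ≠ 0

variable {T}

/-! ### Length and decomposition into indecomposables. -/

lemma len_lt_of_mono {X Y : C} (hY : T.fin Y) (f : X ⟶ Y) [Mono f] (hf : ¬ IsIso f) :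
    T.len X < T.len Y := by
  have h := shortExact_cokernel f
  have hadd : T.len Y = T.len X + T.len (cokernel f) := T.len_add h hY
  have hne : T.len (cokernel f) ≠ 0 := fun h0 =>
    hf (h.isIso_f_iff.2 (T.isZero_of_len (T.of_epi (cokernel.π f) inferInstance hY) h0))
  omega

lemma len_lt_of_epi {X Y : C} (hX : T.fin X) (f : X ⟶ Y) [Epi f] (hf : ¬ IsIso f) :
    T.len Y < T.len X := by
  have h := shortExact_kernel f
  have hadd : T.len X = T.len (kernel f) + T.len Y := T.len_add h hX
  have hne : T.len (kernel f) ≠ 0 := fun h0 =>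
    hf (h.isIso_g_iff.2 (T.isZero_of_len (T.of_mono (kernel.ι f) inferInstance hX) h0))
  omega

/-- Every finite object is a finite direct sum of indecomposable ones. -/
lemma exists_decomposition {X : C} (hX : T.fin X) :
    ∃ (ι : Type) (_ : Fintype ι) (Z : ι → C) (s : ∀ j, Z j ⟶ X) (r : ∀ j, X ⟶ Z j),
      (∀ j, T.Ind (Z j)) ∧ (∀ j, s j ≫ r j = 𝟙 _) ∧ ∑ j, r j ≫ s j = 𝟙 X := by
  induction hn : T.len X using Nat.strong_induction_on generalizing X with
  | _ n ih =>
  by_cases h0 : IsZero X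
  · exact ⟨Empty, inferInstance, fun j => j.elim, fun j => j.elim, fun j => j.elim,
      fun j => j.elim, fun j => j.elim, h0.eq_of_src _ _⟩
  by_cases hi : IsIndec X
  · exact ⟨Unit, inferInstance, fun _ => X, fun _ => 𝟙 X, fun _ => 𝟙 X, fun _ => ⟨hX, hi⟩,
      by simp, by simp⟩
  have : ∃ p : X ⟶ X, p ≫ p = p ∧ p ≠ 0 ∧ p ≠ 𝟙 X := by
    by_contra! H
    exact hi ⟨h0, fun p hp => or_iff_not_imp_left.2 (H p hp)⟩
  obtain ⟨p, hp, hp0, hp1⟩ := this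
  have key : ∀ q : X ⟶ X, q ≫ q = q → q ≠ 𝟙 X →
      ∃ (ι : Type) (_ : Fintype ι) (Z : ι → C) (s : ∀ j, Z j ⟶ X) (r : ∀ j, X ⟶ Z j),
        (∀ j, T.Ind (Z j)) ∧ (∀ j, s j ≫ r j = 𝟙 _) ∧ ∑ j, r j ≫ s j = q := by
    intro q hq hq1
    have hme : image.ι q ≫ factorThruImage q = 𝟙 _ := by
      rw [← cancel_mono (image.ι q), ← cancel_epi (factorThruImage q)]
      simp [hq]
    have hlt : T.len (image q) < T.len X := by
      refine len_lt_of_mono hX (image.ι q) fun hiso => hq1 ?_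
      rw [← image.fac q, ← cancel_epi (image.ι q), reassoc_of% hme, Category.comp_id]
    obtain ⟨ι, hι, Z, s, r, h1, h2, h3⟩ :=
      ih _ (hn ▸ hlt) (T.of_mono (image.ι q) inferInstance hX) rfl
    refine ⟨ι, hι, Z, fun j => s j ≫ image.ι q, fun j => factorThruImage q ≫ r j, h1,
      fun j => ?_, ?_⟩
    · simp [reassoc_of% hme, h2]
    · calc ∑ j, (factorThruImage q ≫ r j) ≫ s j ≫ image.ι q
          = factorThruImage q ≫ (∑ j, r j ≫ s j) ≫ image.ι q := by
            simp [Preadditive.sum_comp, Preadditive.comp_sum]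
        _ = q := by simp [h3]
  obtain ⟨ι, hι, Z, s, r, h1, h2, h3⟩ := key p hp hp1
  obtain ⟨ι', hι', Z', s', r', h1', h2', h3'⟩ := key (𝟙 X - p) (by simp [hp]) (by simpa using hp0)
  refine ⟨ι ⊕ ι', inferInstance, Sum.elim Z Z', Sum.rec s s', Sum.rec r r', ?_, ?_, ?_⟩
  · rintro (j | j)
    exacts [h1 j, h1' j]
  · rintro (j | j)
    exacts [h2 j, h2' j]
  · rw [Fintype.sum_sum_type]
    exact (congrArg₂ (· + ·) h3 h3').trans (by simp)

lemma exists_summand_comp_ne_zero {X Y : C} (hX : T.fin X) (u : Y ⟶ X) (hu : u ≠ 0) :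
    ∃ (Z : C) (s : Z ⟶ X) (r : X ⟶ Z), T.Ind Z ∧ s ≫ r = 𝟙 Z ∧ u ≫ r ≠ 0 := by
  obtain ⟨ι, _, Z, s, r, h1, h2, h3⟩ := exists_decomposition hX
  by_contra! H
  apply hu
  calc u = ∑ j, (u ≫ r j) ≫ s j := by
        simp_rw [Category.assoc, ← Preadditive.comp_sum, h3, Category.comp_id]
    _ = 0 := Finset.sum_eq_zero fun j _ => by rw [H _ _ _ (h1 j) (h2 j), zero_comp]

lemma exists_summand_comp_ne_zero' {X Y : C} (hX : T.fin X) (u : X ⟶ Y) (hu : u ≠ 0) :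
    ∃ (Z : C) (s : Z ⟶ X) (r : X ⟶ Z), T.Ind Z ∧ s ≫ r = 𝟙 Z ∧ s ≫ u ≠ 0 := by
  obtain ⟨ι, _, Z, s, r, h1, h2, h3⟩ := exists_decomposition hX
  by_contra! H
  apply hu
  calc u = ∑ j, r j ≫ s j ≫ u := by
        simp_rw [← Category.assoc, ← Preadditive.sum_comp, h3, Category.id_comp]
    _ = 0 := Finset.sum_eq_zero fun j _ => by rw [H _ _ _ (h1 j) (h2 j), comp_zero]

/-! ### Nonvanishing extensions and the paths they produce. -/

lemma exists_summand_not_extZero {F Z : C} (hZ : T.fin Z) (h : ¬ T.ExtZero F Z) :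
    ∃ (Z' : C) (s : Z' ⟶ Z) (r : Z ⟶ Z'), T.Ind Z' ∧ s ≫ r = 𝟙 Z' ∧ ¬ T.ExtZero F Z' := by
  obtain ⟨ι, _, Z', s, r, h1, h2, h3⟩ := exists_decomposition hZ
  by_contra! H
  apply h
  intro K Q i p w hS hQ hQ' g
  choose h hh using fun j => H _ _ _ (h1 j) (h2 j) i p w hS hQ hQ' (g ≫ r j)
  refine ⟨∑ j, h j ≫ s j, ?_⟩
  rw [Preadditive.comp_sum]
  simp_rw [reassoc_of% hh, ← Preadditive.comp_sum, h3, Category.comp_id]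

/-- The path runs through an indecomposable summand of the middle term that `i` meets. An
isomorphism on either side would split the sequence. -/
lemma path_of_nonsplit {Y E F : C} {i : Y ⟶ E} {p : E ⟶ F} {w : i ≫ p = 0}
    (hS : (ShortComplex.mk i p w).ShortExact) (hY : T.Ind Y) (hF : T.Ind F)
    (hi : ∀ r : E ⟶ Y, i ≫ r ≠ 𝟙 Y) : ∃ E', T.Step Y E' ∧ T.Step E' F := by
  have hi0 : i ≠ 0 := fun h0 => by
    have : Mono i := hS.mono_f
    exact hY.2.id_ne_zero ((cancel_mono i).1 (by simp [h0]))
  have hp : ∀ s : F ⟶ E, s ≫ p ≠ 𝟙 F := fun s hs => by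
    obtain ⟨r, hr⟩ := exists_retraction hS s hs
    exact hi r hr
  obtain ⟨E', s, r, hE', hsr, hne⟩ := exists_summand_comp_ne_zero (T.of_ext hS hY.1 hF.1) i hi0
  have hiso : ¬ IsIso (i ≫ r) := fun _ => hi (r ≫ inv (i ≫ r)) (by
    rw [← Category.assoc, IsIso.hom_inv_id])
  refine ⟨E', ⟨hY, hE', i ≫ r, hne, hiso⟩, hE', hF, s ≫ p, fun h0 => ?_, fun _ => ?_⟩
  -- If the summand mapped to zero in `F`, it would factor through `Y`, making `E'` a retract of `Y`
  -- and `i ≫ r` an isomorphism.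
  · obtain ⟨a, ha⟩ := exists_lift hS s h0
    exact hiso (hY.2.isIso_of_retract hE'.2.1 (s := a) (by rw [reassoc_of% ha, hsr])).2
  · exact hp (inv (s ≫ p) ≫ s) (by rw [Category.assoc, IsIso.inv_hom_id])

lemma path_of_not_extZero {Y F : C} (hY : T.Ind Y) (hF : T.Ind F) (h : ¬ T.ExtZero F Y) :
    ∃ E, T.Step Y E ∧ T.Step E F := by
  unfold ExtZero at h
  push Not at h
  obtain ⟨K, Q, i, p, w, hS, hQ, hQ', g, hg⟩ := h
  obtain ⟨E, j, q, p', w', hS', hc⟩ := exists_pushout hS g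
  refine path_of_nonsplit hS' hY hF fun r hr => hg (q ≫ r) ?_
  rw [reassoc_of% hc, hr, Category.comp_id]

/-- Cover `E` by a projective `Q`: the kernel of `Q ⟶ F` is the pullback of `Q` and `N` over `E`.
The map extended to `Q` vanishes on the kernel of `Q ⟶ E`, hence descends to `E`. -/
lemma ExtZero.exists_extension {N E F Y : C} (h : T.ExtZero F Y) {i : N ⟶ E} {p : E ⟶ F}
    {w : i ≫ p = 0} (hS : (ShortComplex.mk i p w).ShortExact) (hE : T.fin E) (g : N ⟶ Y) :
    ∃ h : E ⟶ Y, i ≫ h = g := by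
  have : Mono i := hS.mono_f
  have : Epi p := hS.epi_g
  obtain ⟨Q, q, hQ, hQ', hq⟩ := T.exists_projective hE
  have w' : pullback.fst q i ≫ q ≫ p = 0 := by rw [pullback.condition_assoc, w, comp_zero]
  have hS' : (ShortComplex.mk (pullback.fst q i) (q ≫ p) w').ShortExact := by
    refine shortExact_of_lift w' fun x hx => ?_
    obtain ⟨l, hl⟩ := exists_lift hS (x ≫ q) (by simpa using hx)
    exact ⟨pullback.lift x l hl.symm, pullback.lift_fst _ _ _⟩
  obtain ⟨h', hh'⟩ := h _ _ w' hS' hQ hQ' (pullback.snd q i ≫ g)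
  obtain ⟨m, hm⟩ := exists_desc (shortExact_kernel q) h' (by
    have hc : kernel.ι q ≫ q = 0 ≫ i := by simp
    have := pullback.lift_fst _ _ hc
    rw [← this, Category.assoc, hh', pullback.lift_snd_assoc, zero_comp])
  refine ⟨m, ?_⟩
  rw [← cancel_epi (pullback.snd q i), ← hh', ← pullback.condition_assoc, hm]

/-- The syzygy is projective, so a map from it to `Z` lifts to `J`, and injectivity of `J` extends
the lift. -/
lemma PdLEOne.extZero_of_epi {F J Z : C} (hF : T.PdLEOne F) (hJ : Injective J) (e : J ⟶ Z)
    [Epi e] : T.ExtZero F Z := by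
  intro K Q i p w hS hQ hQ' g
  have := hF i p w hS hQ hQ'
  have : Mono i := hS.mono_f
  exact ⟨Injective.factorThru (Projective.factorThru g e) i ≫ e, by simp⟩

/-- With `Ω` the second syzygy and `Ω ⟶ J` an embedding into an injective, `Ext¹(X, J/Ω)` is
`Ext²(X, Ω)`, which is nonzero when the first syzygy is not projective. A summand of `J/Ω` then has
a path to `X` and is hit by a summand of `J`. -/
lemma exists_injective_path {X : C} (hX : T.Ind X) (h : ¬ T.PdLEOne X) :
    ∃ J, T.Ind J ∧ Injective J ∧ ReflTransGen T.Step J X := by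
  unfold PdLEOne at h
  push Not at h
  obtain ⟨K, Q, i, p, w, hS, hQ, hQ', hK⟩ := h
  have : Mono i := hS.mono_f
  have hKf : T.fin K := T.of_mono i ‹_› hQ
  obtain ⟨Q', q, hQ'f, hQ'p, hq⟩ := T.exists_projective hKf
  obtain ⟨J, j, hJf, hJ, hj⟩ := T.exists_injective (T.of_mono (kernel.ι q) inferInstance hQ'f)
  have hSq := shortExact_kernel q
  have hSj := shortExact_cokernel j
  let v : Q' ⟶ J := Injective.factorThru j (kernel.ι q)
  have hv : kernel.ι q ≫ v = j := Injective.comp_factorThru _ _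
  obtain ⟨g, hg⟩ := exists_desc hSq (v ≫ cokernel.π j) (by rw [reassoc_of% hv, cokernel.condition])
  -- Extending `g` to `Q` and lifting to `J` corrects `v` to a map into the kernel of `q`, which
  -- splits `q` and makes `K` projective.
  have hext : ¬ T.ExtZero X (cokernel j) := fun hext => by
    obtain ⟨h, hh⟩ := hext i p w hS hQ hQ' g
    obtain ⟨l, hl⟩ := exists_lift hSj (v - q ≫ i ≫ Projective.factorThru h (cokernel.π j)) (by
      simp [hh, hg])
    obtain ⟨s, hs⟩ := exists_section hSq l (by
      rw [← cancel_mono j, Category.assoc, hl]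
      simp [hv])
    exact hK (Retract.projective ⟨s, q, hs⟩)
  obtain ⟨Z, s, r, hZ, hsr, hZext⟩ :=
    exists_summand_not_extZero (T.of_epi (cokernel.π j) inferInstance hJf) hext
  have : Epi r := (SplitEpi.mk s hsr).epi
  have hne : cokernel.π j ≫ r ≠ 0 := fun h0 => hZ.2.id_ne_zero
    ((cancel_epi (cokernel.π j ≫ r)).1 (by rw [h0, zero_comp, zero_comp]))
  obtain ⟨J', s', r', hJ', hsr', hne'⟩ := exists_summand_comp_ne_zero' hJf _ hne
  have hJ'inj : Injective J' := Retract.injective ⟨s', r', hsr'⟩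
  obtain ⟨E, h1, h2⟩ := path_of_not_extZero hZ hX hZext
  have hpath : ReflTransGen T.Step Z X := (ReflTransGen.single h1).tail h2
  -- An isomorphism is not an arrow of a path, but then `Z` is itself injective and serves as the
  -- start.
  by_cases hiso : IsIso (s' ≫ cokernel.π j ≫ r)
  · exact ⟨Z, hZ, Injective.of_iso (asIso (s' ≫ cokernel.π j ≫ r)) hJ'inj, hpath⟩
  · exact ⟨J', hJ', hJ'inj, hpath.head ⟨hJ', hZ, _, hne', hiso⟩⟩

/-! ### Nonzero composites in the left part. -/

lemma PdLEOne.of_iso {X Y : C} (hX : T.PdLEOne X) (e : X ≅ Y) : T.PdLEOne Y := by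
  intro K Q i p w hS hQ hQ'
  refine hX i (p ≫ e.inv) (by rw [reassoc_of% w, zero_comp]) ?_ hQ hQ'
  exact ShortComplex.shortExact_of_iso (S₁ := ShortComplex.mk i p w)
    (ShortComplex.isoMk (Iso.refl _) (Iso.refl _) e.symm) hS

lemma Left.of_step {X Y : C} (hY : T.Left Y) (h : T.Step X Y) : T.Left X :=
  ⟨h.1, fun W hW => hY.2 W (hW.tail h)⟩

lemma Left.of_hom {X Y : C} (hY : T.Left Y) (hX : T.Ind X) (f : X ⟶ Y) (hf : f ≠ 0) :
    T.Left X := by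
  by_cases hiso : IsIso f
  · refine ⟨hX, fun W hW => ?_⟩
    rcases hW.cases_tail with rfl | ⟨Z, hZ, h1, h2, g, hg, hg'⟩
    · exact (hY.2 Y .refl).of_iso (asIso f).symm
    · refine hY.2 W (hZ.tail ⟨h1, hY.1, g ≫ f, fun h0 => hg ?_, fun h => hg' ?_⟩)
      · rwa [← cancel_mono f, zero_comp]
      · exact IsIso.of_isIso_comp_right g f
  · exact hY.of_step ⟨hX, hY.1, f, hf, hiso⟩

/-- The inductive step for `Left.comp_ne_zero`. -/
lemma Left.comp_ne_zero_of_extZero {Y F J : C} (hY : T.Left Y) (hF : T.Left F)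
    (H : ∀ N, T.Left N → T.Hit N → T.len N < T.len Y → ∀ F', T.Left F' → T.ExtZero F' N)
    (hJ : T.fin J) (hJ' : Injective J) (u : J ⟶ Y) (hu : u ≠ 0) (f : Y ⟶ F) (hf : f ≠ 0) :
    u ≫ f ≠ 0 := by
  intro huf
  obtain ⟨Z, s, r, hZ, hsr, hne⟩ := exists_summand_comp_ne_zero
    (T.of_mono (image.ι f) inferInstance hF.1.1) (factorThruImage f) (fun h0 => hf (by
      rw [← image.fac f, h0, zero_comp]))
  have : Epi r := (SplitEpi.mk s hsr).epi
  have : Mono s := (SplitMono.mk r hsr).mono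
  have hZL : T.Left Z := hF.of_hom hZ (s ≫ image.ι f) fun h0 => hZ.2.id_ne_zero
    ((cancel_mono (s ≫ image.ι f)).1 (by rw [h0, comp_zero, comp_zero]))
  -- Replacing `f` by an epimorphism `d` onto an indecomposable of the left part makes `u` factor
  -- through a proper kernel, whose summands are shorter than `Y`.
  set d := factorThruImage f ≫ r with hd
  have hud : u ≫ d = 0 := by
    have : u ≫ factorThruImage f = 0 := by
      rw [← cancel_mono (image.ι f), Category.assoc, image.fac, huf, zero_comp]
    rw [hd, reassoc_of% this, zero_comp]
  have hS := shortExact_kernel d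
  obtain ⟨v, hv⟩ := exists_lift hS u hud
  have hNf : T.fin (kernel d) := T.of_mono (kernel.ι d) inferInstance hY.1.1
  obtain ⟨N, s', r', hN, hsr', hne'⟩ := exists_summand_comp_ne_zero hNf v
    (fun h0 => hu (by rw [← hv, h0, zero_comp]))
  have : Mono s' := (SplitMono.mk r' hsr').mono
  have hniso : ¬ IsIso (s' ≫ kernel.ι d) := fun _ => hne (by
    rw [← cancel_epi (s' ≫ kernel.ι d)]; simp)
  have hNL : T.Left N := hY.of_hom hN (s' ≫ kernel.ι d) fun h0 => hN.2.id_ne_zero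
    ((cancel_mono (s' ≫ kernel.ι d)).1 (by rw [h0, comp_zero, comp_zero]))
  have hext := H N hNL ⟨J, v ≫ r', hJ, hJ', hne'⟩
    (len_lt_of_mono hY.1.1 (s' ≫ kernel.ι d) hniso) Z hZL
  -- The projection of the kernel onto `N` extends to `Y`, so `N` is a proper retract of the
  -- indecomposable `Y`.
  obtain ⟨h, hh⟩ := hext.exists_extension hS hY.1.1 r'
  exact hniso (hY.1.2.isIso_of_retract hN.2.1 (r := h) (by rw [Category.assoc, hh, hsr'])).1

/-- An object of the left part that receives a nonzero morphism from an injective object is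
Ext-injective in the left part. -/
lemma Left.extZero {Y F : C} (hY : T.Left Y) (hY' : T.Hit Y) (hF : T.Left F) :
    T.ExtZero F Y := by
  induction hn : T.len Y using Nat.strong_induction_on generalizing Y F with
  | _ n ih =>
  by_contra hcon
  obtain ⟨J, u, hJ, hJ', hu⟩ := hY'
  have hZ : T.ExtZero F (image u) := (hF.2 F .refl).extZero_of_epi hJ' (factorThruImage u)
  have hc : u ≫ cokernel.π u = 0 := cokernel.condition u
  have w : image.ι u ≫ cokernel.π u = 0 := by
    rw [← cancel_epi (factorThruImage u), image.fac_assoc, hc, comp_zero]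
  have hS : (ShortComplex.mk (image.ι u) (cokernel.π u) w).ShortExact :=
    shortExact_of_desc w fun x hx =>
      ⟨cokernel.desc u x (by rw [← image.fac u, Category.assoc, hx, comp_zero]), by simp⟩
  -- `Ext¹(F, Y)` sits between `Ext¹(F, image u)`, which vanishes, and `Ext¹(F, cokernel u)`.
  have hQ : ¬ T.ExtZero F (cokernel u) := fun hQ => hcon fun K Q i p w' hS' hQf hQp g => by
    obtain ⟨h, hh⟩ := hQ i p w' hS' hQf hQp (g ≫ cokernel.π u)
    obtain ⟨z, hz⟩ := exists_lift hS (g - i ≫ Projective.factorThru h (cokernel.π u)) (by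
      simp [hh])
    obtain ⟨z', hz'⟩ := hZ i p w' hS' hQf hQp z
    exact ⟨Projective.factorThru h (cokernel.π u) + z' ≫ image.ι u, by
      rw [Preadditive.comp_add, reassoc_of% hz', hz, add_sub_cancel]⟩
  obtain ⟨Z, s, r, hZi, hsr, hZe⟩ :=
    exists_summand_not_extZero (T.of_epi (cokernel.π u) inferInstance hY.1.1) hQ
  obtain ⟨E, h1, h2⟩ := path_of_not_extZero hZi hF.1 hZe
  have : Epi r := (SplitEpi.mk s hsr).epi
  -- `Z` precedes `F`, so it lies in the left part, yet `u` composes to zero with `Y ⟶ Z`. The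
  -- induction on length feeds the nonvanishing statement this contradicts.
  refine hY.comp_ne_zero_of_extZero ((hF.of_step h2).of_step h1)
    (fun N hN hN' hlt F' hF' => ih _ (hn ▸ hlt) hN hN' hF' rfl) hJ hJ' u hu
    (cokernel.π u ≫ r) (fun h0 => hZi.2.id_ne_zero
      ((cancel_epi (cokernel.π u ≫ r)).1 (by rw [h0, zero_comp, zero_comp]))) ?_
  rw [reassoc_of% hc, zero_comp]

lemma Left.comp_ne_zero {Y F J : C} (hY : T.Left Y) (hF : T.Left F)
    (hJ : T.fin J) (hJ' : Injective J) {u : J ⟶ Y} (hu : u ≠ 0) {f : Y ⟶ F} (hf : f ≠ 0) :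
    u ≫ f ≠ 0 :=
  hY.comp_ne_zero_of_extZero hF (fun _ hN hN' _ _ hF' => hN.extZero hN' hF') hJ hJ' u hu f hf

lemma Left.hit_of_hom {Y F : C} (hY : T.Left Y) (hY' : T.Hit Y) (hF : T.Left F)
    {f : Y ⟶ F} (hf : f ≠ 0) : T.Hit F := by
  obtain ⟨J, u, hJ, hJ', hu⟩ := hY'
  exact ⟨J, u ≫ f, hJ, hJ', hY.comp_ne_zero hF hJ hJ' hu hf⟩

lemma Left.comp_ne_zero' {X Y F : C} (hX : T.Left X) (hX' : T.Hit X) (hY : T.Left Y)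
    (hF : T.Left F) {f : X ⟶ Y} (hf : f ≠ 0) {g : Y ⟶ F} (hg : g ≠ 0) : f ≫ g ≠ 0 := by
  obtain ⟨J, u, hJ, hJ', hu⟩ := hX'
  intro h0
  apply hY.comp_ne_zero hF hJ hJ' (hX.comp_ne_zero hY hJ hJ' hu hf) hg
  rw [Category.assoc, h0, comp_zero]

lemma Left.exists_right_inv {X : C} (hX : T.Left X) (hX' : T.Hit X) {f : X ⟶ X} (hf : f ≠ 0) :
    ∃ g, f ≫ g = 𝟙 X :=
  T.exists_right_inv hX.1.1 f fun g hg => by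
    by_contra hg0
    exact hX.comp_ne_zero' hX' hX hX hf hg0 hg

/-- A nonzero `g` would make `f ≫ g` a nonzero endomorphism of `X`, hence one with a right inverse,
so that `f` splits and is an isomorphism. -/
lemma Left.hom_eq_zero {X Y : C} (hX : T.Left X) (hX' : T.Hit X) (hY : T.Left Y) {f : X ⟶ Y}
    (hf : f ≠ 0) (hf' : ¬ IsIso f) (g : Y ⟶ X) : g = 0 := by
  by_contra hg
  obtain ⟨h, hh⟩ := hX.exists_right_inv hX' (hX.comp_ne_zero' hX' hY hX hf hg)
  exact hf' (hY.1.2.isIso_of_retract hX.1.2.1 (r := g ≫ h) (by simpa using hh)).1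

/-! ### The Euler form and the bound on path lengths. -/

/-- A function that is additive on short exact sequences and vanishes on the simple objects
vanishes. -/
lemma eq_zero_of_additive (χ : C → ℚ)
    (hχ : ∀ S : ShortComplex C, S.ShortExact → T.fin S.X₂ → χ S.X₂ = χ S.X₁ + χ S.X₃)
    (h0 : ∀ i, χ (T.simple i) = 0) {Y : C} (hY : T.fin Y) : χ Y = 0 := by
  induction hn : T.len Y using Nat.strong_induction_on generalizing Y with
  | _ n ih =>
  by_cases hz : IsZero Y
  · have : (ShortComplex.mk (𝟙 Y) (𝟙 Y) (hz.eq_of_src _ _)).ShortExact :=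
      shortExact_of_lift _ fun x _ => ⟨x, Category.comp_id x⟩
    have : χ Y = χ Y + χ Y := hχ _ this hY
    linarith
  · obtain ⟨i, f, hf⟩ := T.exists_mono hY hz
    have hS := shortExact_cokernel f
    have hlt : T.len (cokernel f) < T.len Y := by
      refine len_lt_of_epi hY (cokernel.π f) fun hiso => T.simple_ne i ?_
      exact hS.isIso_g_iff.1 hiso
    have h1 : χ Y = χ (T.simple i) + χ (cokernel f) := hχ _ hS hY
    rw [h1, h0, ih _ (hn ▸ hlt) (T.of_epi (cokernel.π f) inferInstance hY) rfl, add_zero]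

/-- Objects of the left part that are hit by injectives, without nonzero morphisms backwards, are
linearly independent for the Euler form. -/
lemma card_le_rank {n : ℕ} (X : Fin n → C) (hL : ∀ i, T.Left (X i)) (hH : ∀ i, T.Hit (X i))
    (hX : ∀ i j, i < j → ∀ f : X j ⟶ X i, f = 0) : n ≤ T.rank := by
  choose Q p hQ hQ' hp using fun i => T.exists_projective (hL i).1.1
  have hS := fun i => shortExact_kernel (p i)
  have hKf : ∀ i, T.fin (kernel (p i)) := fun i => T.of_mono (kernel.ι (p i)) inferInstance (hQ i)
  have hK : ∀ i, Projective (kernel (p i)) := fun i =>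
    (hL i).2 _ .refl _ _ _ (hS i) (hQ i) (hQ' i)
  -- The Euler form `⟨X i, -⟩` read off a projective resolution of length one. It is additive
  -- because both terms are projective, and Ext-injectivity of `X j` makes `χ i (X j)` the dimension
  -- of `Hom(X i, X j)`.
  let χ : Fin n → C → ℚ := fun i Y => T.hom (Q i) Y - T.hom (kernel (p i)) Y
  have hχ : ∀ i (S : ShortComplex C), S.ShortExact → T.fin S.X₂ →
      χ i S.X₂ = χ i S.X₁ + χ i S.X₃ := by
    intro i S hS' hf
    have := hS'.epi_g
    have h1 := T.hom_add_right hS' hf (hQ i) fun g =>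
      ⟨Projective.factorThru g S.g, Projective.factorThru_comp g S.g⟩
    have h2 := T.hom_add_right hS' hf (hKf i) fun g =>
      ⟨Projective.factorThru g S.g, Projective.factorThru_comp g S.g⟩
    simp only [χ, h1, h2]
    push_cast
    ring
  have hχX : ∀ i j, χ i (X j) = T.hom (X i) (X j) := by
    intro i j
    have h1 := T.hom_add_left (hS i) (hQ i) (hL j).1.1 fun g =>
      (hL j).extZero (hH j) (hL i) _ _ _ (hS i) (hQ i) (hQ' i) g
    simp only [χ]
    rw [show T.hom (Q i) (X j) = _ from h1]
    push_cast
    ring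
  have hlin : LinearIndependent ℚ (fun (i : Fin n) (k : Fin T.rank) => χ i (T.simple k)) := by
    rw [Fintype.linearIndependent_iff]
    intro a ha
    have hzero : ∀ j, ∑ i, a i * χ i (X j) = 0 := by
      intro j
      refine eq_zero_of_additive (T := T) (fun Y => ∑ i, a i * χ i Y) ?_ ?_ (hL j).1.1
      · intro S hS' hf
        simp only [hχ _ S hS' hf, mul_add, Finset.sum_add_distrib]
      · intro k
        simpa using congrFun ha k
    intro j
    induction j using WellFoundedLT.induction with
    | _ j ih =>
    -- Triangularity: earlier coefficients vanish by induction, and later objects have no maps to `X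
    -- j`.
    have h1 : ∑ i, a i * χ i (X j) = a j * χ j (X j) := by
      refine Finset.sum_eq_single j (fun i _ hij => ?_) (by simp)
      rcases lt_or_gt_of_ne hij with h | h
      · rw [ih i h, zero_mul]
      · rw [hχX, (T.hom_eq_zero_iff (hL i).1.1 (hL j).1.1).2 (hX j i h), Nat.cast_zero, mul_zero]
    have h2 : χ j (X j) ≠ 0 := by
      rw [hχX, Nat.cast_ne_zero, Ne, T.hom_eq_zero_iff (hL j).1.1 (hL j).1.1]
      exact fun h => (hL j).1.2.id_ne_zero (h _)
    exact (mul_eq_zero.1 (h1 ▸ hzero j)).resolve_right h2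
  simpa using hlin.fintype_card_le_finrank

/-- A path from an injective object to an object of the left part has length less than the number
of simple objects. -/
lemma length_lt_rank {m : ℕ} (X : ℕ → C) (h0 : Injective (X 0)) (hm : T.Left (X m))
    (hX : ∀ i < m, T.Step (X i) (X (i + 1))) : m < T.rank := by
  have hL : ∀ i ≤ m, T.Left (X i) := by
    intro i hi
    induction hi using Nat.decreasingInduction with
    | self => exact hm
    | of_succ i hi ih => exact ih.of_step (hX i hi)
  have hH : ∀ i ≤ m, T.Hit (X i) := by
    intro i
    induction i with
    | zero => exact fun h => ⟨X 0, 𝟙 _, (hL 0 h).1.1, h0, (hL 0 h).1.2.id_ne_zero⟩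
    | succ i ih =>
      intro hi
      obtain ⟨-, -, f, hf, -⟩ := hX i hi
      exact (hL i (by omega)).hit_of_hom (ih (by omega)) (hL _ hi) hf
  have hf : ∀ i j, i < j → j ≤ m → ∃ f : X i ⟶ X j, f ≠ 0 ∧ ¬ IsIso f := by
    intro i j hij
    induction j, hij using Nat.le_induction with
    | base => exact fun hi => (hX i hi).2.2
    | succ j hij ih =>
      intro hj
      obtain ⟨f, hf, hf'⟩ := ih (by omega)
      obtain ⟨-, -, g, hg, hg'⟩ := hX j hj
      refine ⟨f ≫ g, (hL i (by omega)).comp_ne_zero' (hH i (by omega)) (hL j (by omega)) (hL _ hj)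
        hf hg, fun _ => hf' ?_⟩
      exact ((hL j (by omega)).1.2.isIso_of_retract (hL i (by omega)).1.2.1
        (r := g ≫ inv (f ≫ g)) (by rw [← Category.assoc, IsIso.hom_inv_id])).1
  -- A path of length `m` has `m + 1` terms, whence the strict inequality.
  refine card_le_rank (n := m + 1) (fun i => X i) (fun i => hL i (by omega))
    (fun i => hH i (by omega)) fun i j hij g => ?_
  obtain ⟨f, hf0, hf'⟩ := hf i j hij (by omega)
  exact (hL i (by omega)).hom_eq_zero (hH i (by omega)) (hL j (by omega)) hf0 hf' g

/-! ### Duality and the right part. -/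

open Opposite

variable (T) in
/-- The dual theory. -/
def op : FiniteTheory Cᵒᵖ where
  fin X := T.fin X.unop
  of_mono f _ h := T.of_epi f.unop inferInstance h
  of_epi f _ h := T.of_mono f.unop inferInstance h
  of_ext hS h1 h3 := T.of_ext hS.unop h3 h1
  len X := T.len X.unop
  len_add hS h := (T.len_add hS.unop h).trans (add_comm _ _)
  isZero_of_len h h0 := (T.isZero_of_len h h0).op
  exists_projective h := by
    obtain ⟨J, i, hJ, hJ', hi⟩ := T.exists_injective h
    exact ⟨Opposite.op J, i.op, hJ, Injective.injective_iff_projective_op.1 hJ', inferInstance⟩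
  exists_injective h := by
    obtain ⟨J, i, hJ, hJ', hi⟩ := T.exists_projective h
    exact ⟨Opposite.op J, i.op, hJ, Injective.projective_iff_injective_op.1 hJ', inferInstance⟩
  hom X Y := T.hom Y.unop X.unop
  hom_eq_zero_iff hX hY := (T.hom_eq_zero_iff hY hX).trans
    ⟨fun h f => Quiver.Hom.unop_inj (h f.unop), fun h f => Quiver.Hom.op_inj (h f.op)⟩
  hom_add_left hS hf hY h := (T.hom_add_right hS.unop hf hY fun g => by
    obtain ⟨l, hl⟩ := h g.op
    exact ⟨l.unop, Quiver.Hom.op_inj hl⟩).trans (add_comm _ _)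
  hom_add_right hS hf hY h := (T.hom_add_left hS.unop hf hY fun g => by
    obtain ⟨l, hl⟩ := h g.op
    exact ⟨l.unop, Quiver.Hom.op_inj hl⟩).trans (add_comm _ _)
  exists_left_inv h f hf := by
    obtain ⟨g, hg⟩ := T.exists_right_inv h f.unop fun g hg =>
      Quiver.Hom.op_inj (hf g.op (Quiver.Hom.unop_inj hg))
    exact ⟨g.op, Quiver.Hom.unop_inj hg⟩
  exists_right_inv h f hf := by
    obtain ⟨g, hg⟩ := T.exists_left_inv h f.unop fun g hg =>
      Quiver.Hom.op_inj (hf g.op (Quiver.Hom.unop_inj hg))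
    exact ⟨g.op, Quiver.Hom.unop_inj hg⟩
  rank := T.rank
  simple i := Opposite.op (T.simple i)
  simple_ne i h := T.simple_ne i h.unop
  exists_mono h h0 := by
    obtain ⟨i, f, hf⟩ := T.exists_epi h fun h' => h0 h'.op
    exact ⟨i, f.op, inferInstance⟩
  exists_epi h h0 := by
    obtain ⟨i, f, hf⟩ := T.exists_mono h fun h' => h0 h'.op
    exact ⟨i, f.op, inferInstance⟩

lemma isIndec_op {X : C} (h : IsIndec X) : IsIndec (Opposite.op X) :=
  ⟨fun h0 => h.1 h0.unop, fun p hp => (h.2 p.unop (Quiver.Hom.op_inj hp)).imp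
    (fun h => Quiver.Hom.unop_inj h) (fun h => Quiver.Hom.unop_inj h)⟩

lemma isIndec_of_op {X : C} (h : IsIndec (Opposite.op X)) : IsIndec X :=
  ⟨fun h0 => h.1 h0.op, fun p hp => (h.2 p.op (Quiver.Hom.unop_inj hp)).imp
    (fun h => Quiver.Hom.op_inj h) (fun h => Quiver.Hom.op_inj h)⟩

lemma ind_op_iff {X : C} : T.op.Ind (Opposite.op X) ↔ T.Ind X :=
  and_congr Iff.rfl ⟨isIndec_of_op, isIndec_op⟩

lemma step_op_iff {X Y : C} : T.op.Step (Opposite.op X) (Opposite.op Y) ↔ T.Step Y X := by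
  constructor
  · rintro ⟨hX, hY, f, hf, hf'⟩
    exact ⟨ind_op_iff.1 hY, ind_op_iff.1 hX, f.unop, fun h => hf (Quiver.Hom.unop_inj h),
      fun h => hf' ((isIso_unop_iff f).1 h)⟩
  · rintro ⟨hX, hY, f, hf, hf'⟩
    exact ⟨ind_op_iff.2 hY, ind_op_iff.2 hX, f.op, fun h => hf (Quiver.Hom.op_inj h),
      fun h => hf' ((isIso_op_iff f).1 h)⟩

lemma reflTransGen_step_of_op {X Y : Cᵒᵖ} (h : ReflTransGen T.op.Step X Y) :
    ReflTransGen T.Step Y.unop X.unop := by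
  induction h with
  | refl => exact .refl
  | tail _ h ih => exact ih.head (step_op_iff.1 h)

lemma IdLEOne.op {X : C} (h : T.IdLEOne X) : T.op.PdLEOne (Opposite.op X) := by
  intro K Q i p w hS hQ hQ'
  have := h p.unop i.unop (Quiver.Hom.op_inj w) hS.unop hQ (by
    rw [Injective.injective_iff_projective_op]; exact hQ')
  exact Injective.injective_iff_projective_op.1 this

lemma idLEOne_of_op {X : C} (h : T.op.PdLEOne (Opposite.op X)) : T.IdLEOne X := by
  intro K Q i p w hS hQ hQ'
  rw [Injective.injective_iff_projective_op] at hQ' ⊢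
  exact h p.op i.op (Quiver.Hom.unop_inj w) hS.op hQ hQ'

lemma Right.op {X : C} (h : T.Right X) : T.op.Left (Opposite.op X) :=
  ⟨ind_op_iff.2 h.1, fun W hW => (h.2 W.unop (reflTransGen_step_of_op hW)).op⟩

lemma exists_projective_path {X : C} (hX : T.Ind X) (h : ¬ T.IdLEOne X) :
    ∃ Q, T.Ind Q ∧ Projective Q ∧ ReflTransGen T.Step X Q := by
  obtain ⟨J, hJ, hJ', hp⟩ := exists_injective_path (ind_op_iff.2 hX) fun h' => h (idLEOne_of_op h')
  exact ⟨J.unop, ind_op_iff.1 hJ, Injective.projective_iff_injective_op.2 hJ',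
    reflTransGen_step_of_op hp⟩

/-- A path from an object of the right part to a projective object has length less than the number
of simple objects. -/
lemma length_lt_rank' {m : ℕ} (X : ℕ → C) (h0 : T.Right (X 0)) (hm : Projective (X m))
    (hX : ∀ i < m, T.Step (X i) (X (i + 1))) : m < T.rank := by
  refine length_lt_rank (T := T.op) (fun i => Opposite.op (X (m - i))) ?_ ?_ ?_
  · exact Injective.projective_iff_injective_op.1 hm
  · simpa using h0.op
  · intro i hi
    rw [step_op_iff]
    have := hX (m - (i + 1)) (by omega)
    rwa [show m - (i + 1) + 1 = m - i by omega] at this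

/-- A sequence of arrows is covered by a stretch in the left part starting at an injective, a
stretch in the right part ending at a projective, and a stretch in the middle. -/
lemma exists_middle {m : ℕ} (X : ℕ → C) (L R : C → Prop) (hL : ∀ i ≤ m, L (X i) → T.Left (X i))
    (hR : ∀ i ≤ m, R (X i) → T.Right (X i)) (h0 : Injective (X 0)) (hm : Projective (X m))
    (hX : ∀ i < m, T.Step (X i) (X (i + 1))) :
    m ≤ 2 * T.rank ∨ ∃ i j, i ≤ j ∧ j ≤ m ∧ m ≤ (j - i) + 2 * T.rank ∧
      ¬ L (X i) ∧ ¬ R (X j) := by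
  have hleft : ∀ i ≤ m, L (X i) → i < T.rank := fun i hi h =>
    length_lt_rank X h0 (hL i hi h) fun a ha => hX a (by omega)
  have hright : ∀ j ≤ m, R (X j) → m - j < T.rank := fun j hj h =>
    length_lt_rank' (fun a => X (j + a)) (hR j hj h)
      (by rwa [show j + (m - j) = m by omega]) fun a ha => hX (j + a) (by omega)
  by_cases hr : 2 * T.rank < m
  -- These are the first position where `L` is excluded and the last where `R` is.
  · refine .inr ⟨T.rank, m - T.rank, by omega, by omega, by omega, fun h => ?_, fun h => ?_⟩
    · exact absurd (hleft _ (by omega) h) (lt_irrefl _)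
    · have := hright _ (by omega) h
      omega
  · exact .inl (by omega)

end FiniteTheory

/-! ### Indecomposability via idempotents and via biproducts. -/

section Indecomposable

variable {C : Type*} [Category C] [Abelian C]

lemma isIndec_iff_indecomposable {X : C} : IsIndec X ↔ Indecomposable X := by
  constructor
  · refine fun h => ⟨h.1, fun Y Z e => ?_⟩
    rcases h.2 (e.hom ≫ biprod.fst ≫ biprod.inl ≫ e.inv) (by simp) with h0 | h1
    · left
      rw [IsZero.iff_id_eq_zero]
      calc 𝟙 Y = biprod.inl ≫ e.inv ≫ (e.hom ≫ biprod.fst ≫ biprod.inl ≫ e.inv) ≫ e.hom ≫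
            biprod.fst := by simp
        _ = 0 := by simp [h0]
    · right
      rw [IsZero.iff_id_eq_zero]
      calc 𝟙 Z = biprod.inr ≫ e.inv ≫ 𝟙 X ≫ e.hom ≫ biprod.snd := by simp
        _ = 0 := by simp [← h1]
  · refine fun h => ⟨h.1, fun p hp => ?_⟩
    have hme : ∀ q : X ⟶ X, q ≫ q = q → image.ι q ≫ factorThruImage q = 𝟙 _ := fun q hq => by
      rw [← cancel_mono (image.ι q), ← cancel_epi (factorThruImage q)]
      simp [hq]
    have hz : ∀ q : X ⟶ X, IsZero (image q) → q = 0 := fun q hq => by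
      rw [← image.fac q, hq.eq_of_tgt (factorThruImage q) 0, zero_comp]
    have h0 : ∀ q r : X ⟶ X, q ≫ r = 0 → image.ι q ≫ factorThruImage r = 0 := fun q r hqr => by
      rw [← cancel_mono (image.ι r), ← cancel_epi (factorThruImage q)]
      simp [hqr]
    have hq : (𝟙 X - p) ≫ (𝟙 X - p) = 𝟙 X - p := by simp [hp]
    let e : X ≅ image p ⊞ image (𝟙 X - p) :=
      { hom := biprod.lift (factorThruImage p) (factorThruImage (𝟙 X - p))
        inv := biprod.desc (image.ι p) (image.ι (𝟙 X - p))
        hom_inv_id := by simp [biprod.lift_desc]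
        inv_hom_id := by
          apply biprod.hom_ext' <;> apply biprod.hom_ext <;>
            simp [hme _ hp, hme _ hq, h0 p (𝟙 X - p) (by simp [hp]),
              h0 (𝟙 X - p) p (by simp [hp])] }
    rcases h.2 _ _ e with h | h
    · exact .inl (hz _ h)
    · exact .inr (sub_eq_zero.1 (hz _ h)).symm

end Indecomposable

/-! ### Finiteness of the set of simple modules. -/

section Modules

variable {R : Type u} [Ring R]

/-- Up to isomorphism, only finitely many simple modules receive a nonzero map from a given module
of finite length. -/
lemma exists_simples_of_length (M : ModuleCat.{u} R) [IsArtinian R M] [IsNoetherian R M] :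
    ∃ (n : ℕ) (S : Fin n → ModuleCat.{u} R), (∀ i, IsSimpleModule R (S i)) ∧
      ∀ (N : ModuleCat.{u} R) (f : M →ₗ[R] N), IsSimpleModule R N → f ≠ 0 →
        ∃ i, Nonempty (S i ≅ N) := by
  induction hl : Module.length R M using WellFoundedLT.induction generalizing M with
  | _ l ih =>
  rcases subsingleton_or_nontrivial M with hM | hM
  · exact ⟨0, Fin.elim0, fun i => i.elim0, fun N f _ hf => absurd (Subsingleton.elim f 0) hf⟩
  obtain ⟨P, hP⟩ : ∃ P : Submodule R M, IsAtom P :=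
    ((eq_bot_or_exists_atom_le (⊤ : Submodule R M)).resolve_left top_ne_bot).imp fun _ h => h.1
  have hPs : IsSimpleModule R P := isSimpleModule_iff_isAtom.2 hP
  obtain ⟨n, S, hS, hS'⟩ := ih _ (hl ▸ Submodule.length_quotient_lt P hP.1)
    (ModuleCat.of R (M ⧸ P)) rfl
  refine ⟨n + 1, Fin.cons (ModuleCat.of R P) S, Fin.cases hPs hS, fun N f hN hf => ?_⟩
  by_cases h0 : f.comp P.subtype = 0
  · obtain ⟨i, hi⟩ := hS' N (P.liftQ f fun x hx => LinearMap.congr_fun h0 ⟨x, hx⟩) hN fun h => hf (by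
      rw [← P.liftQ_mkQ f fun x hx => LinearMap.congr_fun h0 ⟨x, hx⟩]
      exact congrArg (fun g : M ⧸ P →ₗ[R] N => g.comp P.mkQ) h)
    exact ⟨i.succ, hi⟩
  · exact ⟨0, ⟨(LinearEquiv.ofBijective (f.comp P.subtype)
      (LinearMap.bijective_of_ne_zero h0)).toModuleIso⟩⟩

/-- Every simple module receives a nonzero map from `R`, which has finite length. -/
lemma exists_simples [IsArtinianRing R] [IsNoetherianRing R] :
    ∃ (n : ℕ) (S : Fin n → ModuleCat.{u} R), (∀ i, IsSimpleModule R (S i)) ∧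
      ∀ N : ModuleCat.{u} R, IsSimpleModule R N → ∃ i, Nonempty (S i ≅ N) := by
  obtain ⟨n, S, h1, h2⟩ := exists_simples_of_length (ModuleCat.of R R)
  refine ⟨n, S, h1, fun N hN => ?_⟩
  have := IsSimpleModule.nontrivial R N
  obtain ⟨x, hx⟩ := exists_ne (0 : N)
  exact h2 N (LinearMap.toSpanSingleton R N x) hN fun h => hx (by
    simpa using LinearMap.congr_fun h (1 : R))

end Modules

/-! ### Modules over a finite-dimensional algebra form a `FiniteTheory`. -/

section Algebra

lemma isArtinianRing_of_finite (k : Type*) [Field k] (R : Type u) [Ring R] [Algebra k R]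
    [Module.Finite k R] : IsArtinianRing R := isArtinian_of_tower k inferInstance

lemma isNoetherianRing_of_finite (k : Type*) [Field k] (R : Type u) [Ring R] [Algebra k R]
    [Module.Finite k R] : IsNoetherianRing R := isNoetherian_of_tower k inferInstance

variable (k : Type*) [Field k] {R : Type u} [Ring R] [Algebra k R] [Module.Finite k R]

open scoped ModuleCat

lemma finite_hom (X Y : ModuleCat.{u} R) [Module.Finite R X] [Module.Finite R Y] :
    Module.Finite k (X ⟶ Y) := by
  have : Module.Finite k X := Module.Finite.trans R X
  have : Module.Finite k Y := Module.Finite.trans R Y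
  have : Module.Finite k (X →ₗ[R] Y) :=
    Module.Finite.of_injective (LinearMap.restrictScalarsₗ k R X Y k)
      (LinearMap.restrictScalars_injective k)
  exact Module.Finite.equiv (ModuleCat.homLinearEquiv (S := k) (M := X) (N := Y)).symm

/-- The envelope is the coinduced module `Hom_k(R, X)`: coextension is right adjoint to the exact
restriction functor, and over a field every module is injective. -/
lemma exists_finite_injective (k : Type*) [Field k] {R : Type u} [Ring R] [Algebra k R]
    [Module.Finite k R] (X : ModuleCat.{u} R) (hX : Module.Finite R X) :
    ∃ (J : ModuleCat.{u} R) (i : X ⟶ J), Module.Finite R J ∧ Injective J ∧ Mono i := by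
  let F := ModuleCat.restrictScalars.{u} (algebraMap k R)
  let G := ModuleCat.coextendScalars.{_, _, u} (algebraMap k R)
  let adj : F ⊣ G := ModuleCat.restrictCoextendScalarsAdj.{u} (algebraMap k R)
  refine ⟨G.obj (F.obj X), adj.unit.app X, ?_, ?_, ?_⟩
  · have : Module.Finite k (F.obj X) := Module.Finite.trans (M := X) (R := k) R
    have : Module.Finite k (F.obj (ModuleCat.of R R)) :=
      let ψ : R →ₗ[k] F.obj (ModuleCat.of R R) :=
        { toFun := fun s => s
          map_add' := fun _ _ => rfl
          map_smul' := fun c s => Algebra.smul_def c s }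
      Module.Finite.of_surjective ψ fun s => ⟨s, rfl⟩
    let φ : G.obj (F.obj X) →ₗ[k] (F.obj (ModuleCat.of R R) →ₗ[k] F.obj X) :=
      { toFun := fun g => ModuleCat.CoextendScalars.equiv _ _ g
        map_add' := fun _ _ => rfl
        map_smul' := fun c g => by
          refine LinearMap.ext fun (s : R) => ?_
          change ModuleCat.CoextendScalars.equiv _ _ g (s * algebraMap k R c : R) = _
          rw [← Algebra.commutes c s]
          exact (ModuleCat.CoextendScalars.equiv _ _ g).map_smul c s }
    have : Module.Finite k (G.obj (F.obj X)) := Module.Finite.of_injective φ fun x y h =>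
      (ModuleCat.CoextendScalars.equiv _ _).injective h
    exact Module.Finite.of_restrictScalars_finite k R _
  · have : Injective (F.obj X) := by
      rw [← Module.injective_iff_injective_object]
      exact Module.injective_of_isSemisimpleRing _ _
    exact Injective.injective_of_adjoint adj _
  · infer_instance

/-- The finitely generated modules over a finite-dimensional algebra. -/
noncomputable def moduleTheory : FiniteTheory (ModuleCat.{u} R) where
  fin X := Module.Finite R X
  of_mono {X Y} f hf hY := by
    have := isNoetherianRing_of_finite k R
    exact Module.Finite.of_injective f.hom ((ModuleCat.mono_iff_injective f).1 hf)
  of_epi {X Y} f hf hX := Module.Finite.of_surjective f.hom ((ModuleCat.epi_iff_surjective f).1 hf)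
  of_ext {S} hS h1 h3 := by
    have := isNoetherianRing_of_finite k R
    have : IsNoetherian R S.X₂ := isNoetherian_of_range_eq_ker S.f.hom S.g.hom
      hS.exact.moduleCat_range_eq_ker
    infer_instance
  len X := (Module.length R X).toNat
  len_add {S} hS h := by
    have := isNoetherianRing_of_finite k R
    have := isArtinianRing_of_finite k R
    have hadd := Module.length_eq_add_of_exact S.f.hom S.g.hom hS.moduleCat_injective_f
      hS.moduleCat_surjective_g
      ((ShortComplex.ShortExact.moduleCat_exact_iff_function_exact S).1 hS.exact)
    have hne : Module.length R S.X₂ ≠ ⊤ := Module.length_ne_top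
    rw [hadd] at hne ⊢
    exact ENat.toNat_add (fun h => hne (by rw [h, top_add])) fun h => hne (by rw [h, add_top])
  isZero_of_len {X} h h0 := by
    have := isNoetherianRing_of_finite k R
    have := isArtinianRing_of_finite k R
    have hne : Module.length R X ≠ ⊤ := Module.length_ne_top
    have := Module.length_eq_zero_iff.1 ((ENat.toNat_eq_zero.1 h0).resolve_right hne)
    exact ModuleCat.isZero_of_subsingleton X
  exists_projective {X} h := by
    obtain ⟨n, f, hf⟩ := Module.Finite.exists_fin' R X
    exact ⟨ModuleCat.of R (Fin n → R), ModuleCat.ofHom f, inferInstance,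
      (IsProjective.iff_projective _).1 inferInstance, (ModuleCat.epi_iff_surjective _).2 hf⟩
  exists_injective {X} h := exists_finite_injective k X h
  hom X Y := Module.finrank k (X ⟶ Y)
  hom_eq_zero_iff {X Y} hX hY := by
    have := finite_hom k X Y
    rw [Module.finrank_eq_zero_iff_of_free, subsingleton_iff_forall_eq 0]
  hom_add_left {S Y} hS h hY hext := by
    have := finite_hom k S.X₂ Y
    have := hS.epi_g
    rw [← (Linear.leftComp k Y S.f).finrank_range_add_finrank_ker,
      LinearMap.range_eq_top.2 fun g => hext g, finrank_top]
    congr 1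
    rw [← LinearMap.finrank_range_of_inj (f := Linear.leftComp k Y S.g)
      fun a b hab => (cancel_epi S.g).1 hab]
    suffices h : (Linear.leftComp k Y S.f).ker = (Linear.leftComp k Y S.g).range by rw [h]
    ext x
    constructor
    · exact fun hx => exists_desc hS x hx
    · rintro ⟨y, rfl⟩
      exact (S.zero_assoc y).trans zero_comp
  hom_add_right {S Y} hS h hY hext := by
    have := finite_hom k Y S.X₂
    have := hS.mono_f
    rw [← (Linear.rightComp k Y S.g).finrank_range_add_finrank_ker,
      LinearMap.range_eq_top.2 fun g => hext g, finrank_top, add_comm]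
    congr 1
    rw [← LinearMap.finrank_range_of_inj (f := Linear.rightComp k Y S.f)
      fun a b hab => (cancel_mono S.f).1 hab]
    suffices h : (Linear.rightComp k Y S.g).ker = (Linear.rightComp k Y S.f).range by rw [h]
    ext x
    constructor
    · exact fun hx => exists_lift hS x hx
    · rintro ⟨y, rfl⟩
      exact (Category.assoc _ _ _).trans ((congrArg (y ≫ ·) S.zero).trans comp_zero)
  exists_left_inv {X} h f hf := by
    have := finite_hom k X X
    exact LinearMap.injective_iff_surjective.1
      ((injective_iff_map_eq_zero (Linear.rightComp k X f)).2 hf) (𝟙 X)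
  exists_right_inv {X} h f hf := by
    have := finite_hom k X X
    exact LinearMap.injective_iff_surjective.1
      ((injective_iff_map_eq_zero (Linear.leftComp k X f)).2 hf) (𝟙 X)
  rank :=
    have := isNoetherianRing_of_finite k R
    have := isArtinianRing_of_finite k R
    (exists_simples (R := R)).choose
  simple :=
    have := isNoetherianRing_of_finite k R
    have := isArtinianRing_of_finite k R
    (exists_simples (R := R)).choose_spec.choose
  simple_ne i h0 := by
    have := isNoetherianRing_of_finite k R
    have := isArtinianRing_of_finite k R
    have hs := (exists_simples (R := R)).choose_spec.choose_spec.1 i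
    have := IsSimpleModule.nontrivial R ((exists_simples (R := R)).choose_spec.choose i)
    exact not_subsingleton _ (ModuleCat.subsingleton_of_isZero h0)
  exists_mono {X} h h0 := by
    have := isNoetherianRing_of_finite k R
    have := isArtinianRing_of_finite k R
    have hX : Nontrivial X := not_subsingleton_iff_nontrivial.1 fun _ =>
      h0 (ModuleCat.isZero_of_subsingleton X)
    obtain ⟨P, hP⟩ : ∃ P : Submodule R X, IsAtom P :=
      ((eq_bot_or_exists_atom_le (⊤ : Submodule R X)).resolve_left top_ne_bot).imp fun _ h => h.1
    obtain ⟨i, ⟨e⟩⟩ := (exists_simples (R := R)).choose_spec.choose_spec.2 (ModuleCat.of R P)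
      (isSimpleModule_iff_isAtom.2 hP)
    have : Mono (ModuleCat.ofHom P.subtype) := (ModuleCat.mono_iff_injective _).2 P.subtype_injective
    exact ⟨i, e.hom ≫ ModuleCat.ofHom P.subtype, inferInstance⟩
  exists_epi {X} h h0 := by
    have := isNoetherianRing_of_finite k R
    have := isArtinianRing_of_finite k R
    have hX : Nontrivial X := not_subsingleton_iff_nontrivial.1 fun _ =>
      h0 (ModuleCat.isZero_of_subsingleton X)
    obtain ⟨P, hP⟩ : ∃ P : Submodule R X, IsCoatom P :=
      ((eq_top_or_exists_le_coatom (⊥ : Submodule R X)).resolve_left bot_ne_top).imp fun _ h => h.1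
    obtain ⟨i, ⟨e⟩⟩ := (exists_simples (R := R)).choose_spec.choose_spec.2 (ModuleCat.of R (X ⧸ P))
      (isSimpleModule_iff_isCoatom.2 hP)
    have : Epi (ModuleCat.ofHom P.mkQ) := (ModuleCat.epi_iff_surjective _).2 P.mkQ_surjective
    exact ⟨i, ModuleCat.ofHom P.mkQ ≫ e.inv, epi_comp _ _⟩

end Algebra

/-! ### Homological dimension along a surjection with idempotent kernel. -/

section ChangeOfRings

variable {R S : Type u} [Ring R] [Ring S] (φ : R →+* S)

/-- The kernel of `φ` is an idempotent ideal. -/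
def IdempotentKernel : Prop :=
  ∀ j, φ j = 0 → j ∈ AddSubgroup.closure {x | ∃ a b, φ a = 0 ∧ φ b = 0 ∧ x = a * b}

variable {φ}

/-- A lift of `a` through `f` kills `(ker φ) K`, because `ker φ` acts as zero on `E`. By `hker` it
then factors through `a`. -/
lemma exists_section_of_projective (hφ : Function.Surjective φ) {K L E : Type*}
    [AddCommGroup K] [AddCommGroup L] [AddCommGroup E] [Module R K] [Module R L] [Module S L]
    [Module R E] [Module S E] (hL : ∀ (r : R) (x : L), φ r • x = r • x)
    (hE : ∀ (r : R) (x : E), φ r • x = r • x) [Module.Projective R K] (a : K →ₗ[R] L)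
    (ha : Function.Surjective a)
    (hker : ∀ x, a x = 0 → x ∈ AddSubgroup.closure {x | ∃ (j : R) (y : K), φ j = 0 ∧ x = j • y})
    (f : E →ₗ[S] L) (hf : Function.Surjective f) : ∃ h : L →ₗ[S] E, f.comp h = .id := by
  let f' : E →ₗ[R] L :=
    { toFun := f, map_add' := f.map_add, map_smul' := fun r x => by
        rw [← hE, map_smul, hL, RingHom.id_apply] }
  obtain ⟨b, hb⟩ := Module.projective_lifting_property f' a hf
  have hle : LinearMap.ker a ≤ LinearMap.ker b := by
    intro x hx
    have : AddSubgroup.closure {x | ∃ (j : R) (y : K), φ j = 0 ∧ x = j • y} ≤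
        b.toAddMonoidHom.ker := by
      rw [AddSubgroup.closure_le]
      rintro _ ⟨j, y, hj, rfl⟩
      change b (j • y) = 0
      rw [map_smul, ← hE, hj, zero_smul]
    exact this (hker x hx)
  let h : L →ₗ[R] E := ((LinearMap.ker a).liftQ b hle).comp
    (a.quotKerEquivOfSurjective ha).symm.toLinearMap
  have hh : ∀ x, h (a x) = b x := fun x => by
    have : (a.quotKerEquivOfSurjective ha).symm (a x) = (LinearMap.ker a).mkQ x := by
      rw [LinearEquiv.symm_apply_eq]; rfl
    simp [h, this]
  refine ⟨{ toFun := h, map_add' := h.map_add, map_smul' := fun s x => ?_ }, ?_⟩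
  · obtain ⟨r, rfl⟩ := hφ s
    rw [hL, map_smul, RingHom.id_apply, hE]
  · ext1 x
    obtain ⟨y, rfl⟩ := ha x
    change f (h (a y)) = a y
    rw [hh]
    exact LinearMap.congr_fun hb y

lemma projective_of_surjective (hφ : Function.Surjective φ) {K L : Type*}
    [AddCommGroup K] [AddCommGroup L] [Module R K] [Module S L] [Module.Projective R K]
    (a : K →+ L) (ha : Function.Surjective a) (ha' : ∀ (r : R) (x : K), a (r • x) = φ r • a x)
    (hker : ∀ x, a x = 0 → x ∈ AddSubgroup.closure {x | ∃ (j : R) (y : K), φ j = 0 ∧ x = j • y}) :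
    Module.Projective S L := by
  refine Module.Projective.of_lifting_property'' fun f hf => ?_
  let : Module R L := Module.compHom L φ
  let m : Module R (L →₀ S) := Module.compHom (L →₀ S) φ
  exact @exists_section_of_projective R S _ _ φ hφ K L (L →₀ S) _ _ _ _ _ _ m _
    (fun _ _ => rfl) (fun _ _ => rfl) _ { a with map_smul' := ha' } ha hker f hf

/-- Let `J = ker φ` and let `K`, `L` be the two kernels. The kernel of `K ⟶ L` is the set of vectors
with entries in `J`. As `J M = 0`, these all lie in `K`, so `J = J²` puts them in `J K`, and `L = K
/ J K` is projective over `S`. -/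
lemma projective_ker_linearCombination (hφ : Function.Surjective φ) (hJ : IdempotentKernel φ)
    {M : Type u} [AddCommGroup M] [Module R M] [Module S M]
    (hM : ∀ (r : R) (m : M), φ r • m = r • m)
    (hK : Module.Projective R (LinearMap.ker (Finsupp.linearCombination R (id : M → M)))) :
    Module.Projective S (LinearMap.ker (Finsupp.linearCombination S (id : M → M))) := by
  let π : (M →₀ R) →+ (M →₀ S) := Finsupp.mapRange.addMonoidHom φ.toAddMonoidHom
  have hπ : ∀ x : M →₀ R, Finsupp.linearCombination S (id : M → M) (π x) =
        Finsupp.linearCombination R (id : M → M) x := by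
    intro x
    induction x using Finsupp.induction_linear with
    | zero => simp
    | add x y hx hy => rw [map_add, map_add, hx, hy, map_add]
    | single m r => simp [π, hM]
  have hmem : ∀ (m : M) (j : R), φ j = 0 →
      Finsupp.single m j ∈ LinearMap.ker (Finsupp.linearCombination R (id : M → M)) :=
    fun m j hj => by simp [← hM, hj]
  let a : LinearMap.ker (Finsupp.linearCombination R (id : M → M)) →+
      LinearMap.ker (Finsupp.linearCombination S (id : M → M)) :=
    { toFun := fun x => ⟨π x.1, by rw [LinearMap.mem_ker, hπ]; exact x.2⟩
      map_zero' := Subtype.ext (map_zero π)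
      map_add' := fun x y => Subtype.ext (map_add π x.1 y.1) }
  refine projective_of_surjective hφ a ?_ ?_ ?_
  · intro y
    obtain ⟨x, hx⟩ : ∃ x, π x = y.1 := Finsupp.mapRange_surjective φ (map_zero φ) hφ y.1
    refine ⟨⟨x, ?_⟩, Subtype.ext hx⟩
    rw [LinearMap.mem_ker, ← hπ, hx]
    exact y.2
  · intro r x
    apply Subtype.ext
    ext m
    exact φ.map_mul r (x.1 m)
  · intro x hx
    have hx' : ∀ m, φ (x.1 m) = 0 := fun m => DFunLike.congr_fun (congrArg Subtype.val hx) m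
    have : x = ∑ m ∈ x.1.support, ⟨_, hmem m (x.1 m) (hx' m)⟩ := by
      apply Subtype.ext
      rw [AddSubmonoidClass.coe_finsetSum]
      exact x.1.sum_single.symm
    rw [this]
    refine AddSubgroup.sum_mem _ fun m _ => ?_
    set N := (AddSubgroup.closure {x : LinearMap.ker
      (Finsupp.linearCombination R (id : M → M)) | ∃ (j : R) (y : _), φ j = 0 ∧ x = j • y})
    have key : AddSubgroup.closure {x | ∃ a b, φ a = 0 ∧ φ b = 0 ∧ x = a * b} ≤
        (N.map (LinearMap.ker (Finsupp.linearCombination R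
          (id : M → M))).subtype.toAddMonoidHom).comap (Finsupp.singleAddHom m) := by
      rw [AddSubgroup.closure_le]
      rintro _ ⟨c, d, hc, hd, rfl⟩
      exact ⟨c • ⟨_, hmem m d hd⟩, AddSubgroup.subset_closure ⟨c, _, hc, rfl⟩, by simp⟩
    obtain ⟨y, hy, hy'⟩ := key (hJ _ (hx' m))
    have : (⟨_, hmem m (x.1 m) (hx' m)⟩ : LinearMap.ker _) = y := Subtype.ext hy'.symm
    rw [this]
    exact hy

lemma shortExact_of_function_exact {R : Type u} [Ring R] {X Y Z : ModuleCat.{u} R}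
    {f : X →ₗ[R] Y} {g : Y →ₗ[R] Z} (hf : Function.Injective f) (hg : Function.Surjective g)
    (h : Function.Exact f g) :
    (ShortComplex.mk (ModuleCat.ofHom f) (ModuleCat.ofHom g)
      (ModuleCat.hom_ext (LinearMap.ext h.apply_apply_eq_zero))).ShortExact :=
  .mk' ((ShortComplex.ShortExact.moduleCat_exact_iff_function_exact _).2 h)
    ((ModuleCat.mono_iff_injective _).2 hf) ((ModuleCat.epi_iff_surjective _).2 hg)

/-- The free presentation on all elements of `M` has the same basis over both rings, so the two
syzygies can be compared directly. -/
lemma hasProjectiveDimensionLE_one_iff (R : Type u) [Ring R] (M : ModuleCat.{u} R) :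
    HasProjectiveDimensionLE M 1 ↔
      Module.Projective R (LinearMap.ker (Finsupp.linearCombination R (id : M → M))) := by
  have hS := shortExact_of_function_exact
    (X := ModuleCat.of R (LinearMap.ker (Finsupp.linearCombination R (id : M → M))))
    (Y := ModuleCat.of R (M →₀ R)) (Z := M) (Submodule.subtype_injective _)
    (fun m => ⟨Finsupp.single m 1, by simp⟩)
    (LinearMap.exact_subtype_ker_map (Finsupp.linearCombination R (id : M → M)))
  have h1 := hS.hasProjectiveDimensionLT_X₃_iff 0 ((IsProjective.iff_projective _).1
    (inferInstanceAs (Module.Projective R (M →₀ R))))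
  have h2 : Projective (ModuleCat.of R _) ↔ _ := projective_iff_hasProjectiveDimensionLT_one
    (X := ModuleCat.of R (LinearMap.ker (Finsupp.linearCombination R (id : M → M))))
  exact h1.trans (h2.symm.trans (IsProjective.iff_projective _).symm)

/-- Projective dimension at most one descends along a surjection with idempotent kernel. -/
lemma hasProjectiveDimensionLE_one_of_restrictScalars (hφ : Function.Surjective φ)
    (hJ : IdempotentKernel φ) (M : ModuleCat.{u} S)
    (h : HasProjectiveDimensionLE ((ModuleCat.restrictScalars φ).obj M) 1) :
    HasProjectiveDimensionLE M 1 := by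
  rw [hasProjectiveDimensionLE_one_iff] at h ⊢
  let : Module R M := Module.compHom M φ
  exact projective_ker_linearCombination hφ hJ (fun _ _ => rfl) h

/-- A module structure over the target of a surjection whose kernel acts as zero. -/
@[reducible]
noncomputable def descendModule (hφ : Function.Surjective φ) (V : Type u) [AddCommGroup V]
    [Module R V] (h : ∀ j, φ j = 0 → ∀ v : V, j • v = 0) : Module S V :=
  letI : SMul S V := ⟨fun s v => Function.surjInv hφ s • v⟩
  hφ.moduleLeft φ fun c x => by
    change Function.surjInv hφ (φ c) • x = c • x
    rw [← sub_eq_zero, ← sub_smul]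
    exact h _ (by rw [map_sub, Function.surjInv_eq hφ, sub_self]) x

lemma descendModule_smul (hφ : Function.Surjective φ) (V : Type u) [AddCommGroup V]
    [Module R V] (h : ∀ j, φ j = 0 → ∀ v : V, j • v = 0) (r : R) (v : V) :
    letI := descendModule hφ V h
    φ r • v = r • v := by
  change Function.surjInv hφ (φ r) • v = r • v
  rw [← sub_eq_zero, ← sub_smul]
  exact h _ (by rw [map_sub, Function.surjInv_eq hφ, sub_self]) v

variable (φ) in
/-- The largest submodule on which the kernel of `φ` acts as zero. -/
def kerTorsion (W : Type u) [AddCommGroup W] [Module R W] : Submodule R W where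
  carrier := {w | ∀ j, φ j = 0 → j • w = 0}
  add_mem' ha hb j hj := by rw [smul_add, ha j hj, hb j hj, add_zero]
  zero_mem' j _ := smul_zero j
  smul_mem' r w hw j hj := by rw [smul_smul, hw (j * r) (by rw [map_mul, hj, zero_mul])]

lemma smul_kerTorsion (W : Type u) [AddCommGroup W] [Module R W] (j : R) (hj : φ j = 0)
    (v : kerTorsion φ W) : j • v = 0 := Subtype.ext (v.2 j hj)

/-- `kerTorsion` is `Hom_R(S, -)`: a map from an `S`-module to `W` automatically lands in it. -/
lemma injective_kerTorsion (hφ : Function.Surjective φ) (W : Type u) [AddCommGroup W]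
    [Module R W] (hW : Module.Injective R W) :
    let := descendModule hφ (kerTorsion φ W) (smul_kerTorsion W)
    Module.Injective S (kerTorsion φ W) := by
  let := descendModule hφ (kerTorsion φ W) (smul_kerTorsion W)
  constructor
  intro X Y _ _ _ _ f hf g
  let : Module R X := Module.compHom X φ
  let : Module R Y := Module.compHom Y φ
  let f' : X →ₗ[R] Y :=
    { toFun := f, map_add' := f.map_add, map_smul' := fun r x => f.map_smul (φ r) x }
  let g' : X →ₗ[R] W :=
    { toFun := fun x => (g x).1
      map_add' := fun x y => by rw [map_add]; rfl
      map_smul' := fun r x => by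
        have h1 : g (r • x) = φ r • g x := g.map_smul (φ r) x
        rw [h1, descendModule_smul]
        rfl }
  obtain ⟨h, hh⟩ := hW.out f' hf g'
  have hmem : ∀ y, h y ∈ kerTorsion φ W := fun y j hj => by
    rw [← map_smul]
    change h (φ j • y) = 0
    rw [hj, zero_smul, map_zero]
  refine ⟨{ toFun := fun y => ⟨h y, hmem y⟩
            map_add' := fun x y => Subtype.ext (h.map_add x y)
            map_smul' := fun s y => ?_ }, fun x => Subtype.ext (hh x)⟩
  obtain ⟨r, rfl⟩ := hφ s
  rw [RingHom.id_apply, descendModule_smul]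
  exact Subtype.ext (h.map_smul r y)

/-- Injective dimension at most one descends along a surjection with idempotent kernel. -/
lemma hasInjectiveDimensionLE_one_of_restrictScalars (hφ : Function.Surjective φ)
    (hJ : IdempotentKernel φ) (M : ModuleCat.{u} S)
    (h : HasInjectiveDimensionLE ((ModuleCat.restrictScalars φ).obj M) 1) :
    HasInjectiveDimensionLE M 1 := by
  set N := (ModuleCat.restrictScalars φ).obj M with hN
  let E := Injective.under N
  let i : N →ₗ[R] E := (Injective.ι N).hom
  have hi : Function.Injective i := (ModuleCat.mono_iff_injective (Injective.ι N)).1 inferInstance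
  let D := E ⧸ LinearMap.range i
  have hE : Module.Injective R E := by
    rw [Module.injective_iff_injective_object]
    exact inferInstanceAs (Injective (Injective.under N))
  have hD : Module.Injective R D := by
    have hS := shortExact_of_function_exact (Z := ModuleCat.of R D) hi
      (Submodule.mkQ_surjective _) (LinearMap.exact_map_mkQ_range i)
    rw [Module.injective_iff_injective_object, injective_iff_hasInjectiveDimensionLT_one]
    exact (hS.hasInjectiveDimensionLT_X₃_iff 0 (inferInstanceAs (Injective (Injective.under N)))).2 h
  let := descendModule hφ (kerTorsion φ E) (smul_kerTorsion E)
  let := descendModule hφ (kerTorsion φ D) (smul_kerTorsion D)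
  have hE' := injective_kerTorsion hφ E hE
  have hD' := injective_kerTorsion hφ D hD
  have himem : ∀ x, i x ∈ kerTorsion φ E := fun x j hj => by
    rw [← map_smul]
    have : j • x = 0 := by
      change φ j • (show M from x) = 0
      rw [hj, zero_smul]
    rw [this, map_zero]
  let i' : M →ₗ[S] kerTorsion φ E :=
    { toFun := fun x => ⟨i x, himem x⟩
      map_add' := fun x y => Subtype.ext (i.map_add x y)
      map_smul' := fun s x => by
        obtain ⟨r, rfl⟩ := hφ s
        rw [RingHom.id_apply, descendModule_smul]
        exact Subtype.ext (i.map_smul r x) }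
  let p' : kerTorsion φ E →ₗ[S] kerTorsion φ D :=
    { toFun := fun x => ⟨(LinearMap.range i).mkQ x.1, fun j hj => by
        rw [← map_smul, x.2 j hj, map_zero]⟩
      map_add' := fun x y => Subtype.ext (map_add (LinearMap.range i).mkQ x.1 y.1)
      map_smul' := fun s x => by
        obtain ⟨r, rfl⟩ := hφ s
        rw [RingHom.id_apply, descendModule_smul, descendModule_smul]
        exact Subtype.ext (map_smul (LinearMap.range i).mkQ r x.1) }
  have hi' : Function.Injective i' := fun x y hxy => hi (congrArg Subtype.val hxy)
  -- If `J = ker φ` sends `x` into the image of `M`, then `J²` kills `x`, hence so does `J`. Thus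
  -- torsion elements of the quotient lift to torsion elements.
  have hp' : Function.Surjective p' := by
    rintro ⟨d, hd⟩
    obtain ⟨x, rfl⟩ := Submodule.mkQ_surjective _ d
    have hx : ∀ j, φ j = 0 → j • x ∈ LinearMap.range i := fun j hj => by
      have := hd j hj
      rwa [← map_smul, Submodule.mkQ_apply, Submodule.Quotient.mk_eq_zero] at this
    refine ⟨⟨x, fun j hj => ?_⟩, rfl⟩
    have hle : AddSubgroup.closure {x | ∃ a b, φ a = 0 ∧ φ b = 0 ∧ x = a * b} ≤
        ((AddMonoidHom.flip (smulAddHom R E)) x).ker := by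
      rw [AddSubgroup.closure_le]
      rintro _ ⟨a, b, ha, hb, rfl⟩
      obtain ⟨m, hm⟩ := hx b hb
      change (a * b) • x = 0
      rw [mul_smul, ← hm]
      exact himem m a ha
    exact hle (hJ j hj)
  have hex : Function.Exact i' p' := by
    intro y
    constructor
    · intro hy
      have : (LinearMap.range i).mkQ y.1 = 0 := congrArg Subtype.val hy
      rw [Submodule.mkQ_apply, Submodule.Quotient.mk_eq_zero] at this
      obtain ⟨m, hm⟩ := this
      exact ⟨m, Subtype.ext hm⟩
    · rintro ⟨m, rfl⟩
      refine Subtype.ext ?_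
      change (LinearMap.range i).mkQ (i m) = 0
      rw [Submodule.mkQ_apply, Submodule.Quotient.mk_eq_zero]
      exact ⟨m, rfl⟩
  have hS := shortExact_of_function_exact (Y := ModuleCat.of S (kerTorsion φ E))
    (Z := ModuleCat.of S (kerTorsion φ D)) hi' hp' hex
  refine (hS.hasInjectiveDimensionLT_X₃_iff 0
    ((Module.injective_iff_injective_object _ _).1 hE')).1 ?_
  rw [← injective_iff_hasInjectiveDimensionLT_one]
  exact (Module.injective_iff_injective_object _ _).1 hD'

end ChangeOfRings

/-! ### Restriction along a surjection: fullness, indecomposability, finiteness. -/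

section Restriction

variable {R S : Type u} [Ring R] [Ring S] {φ : R →+* S}

lemma full_restrictScalars (hφ : Function.Surjective φ) :
    (ModuleCat.restrictScalars.{u} φ).Full where
  map_surjective {X Y} g :=
    ⟨ModuleCat.ofHom (X := X) (Y := Y)
      { toFun := fun x => g.hom x
        map_add' := fun x y => g.hom.map_add x y
        map_smul' := fun s x => by
          obtain ⟨r, rfl⟩ := hφ s
          exact g.hom.map_smul r x }, rfl⟩

lemma isIndec_restrictScalars (hφ : Function.Surjective φ) {X : ModuleCat.{u} S}
    (hX : IsIndec X) : IsIndec ((ModuleCat.restrictScalars.{u} φ).obj X) := by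
  have := full_restrictScalars hφ
  set F := ModuleCat.restrictScalars.{u} φ
  refine ⟨fun h => hX.id_ne_zero (F.map_injective (h.eq_of_src _ _)), fun p hp => ?_⟩
  obtain ⟨q, rfl⟩ := F.map_surjective p
  rcases hX.2 q (F.map_injective (by rw [F.map_comp, hp])) with rfl | rfl
  · exact .inl (F.map_zero _ _)
  · exact .inr (F.map_id _)

lemma finite_restrictScalars (hφ : Function.Surjective φ) {X : ModuleCat.{u} S}
    (hX : Module.Finite S X) : Module.Finite R ((ModuleCat.restrictScalars.{u} φ).obj X) := by
  obtain ⟨n, f, hf⟩ := Module.Finite.exists_fin (R := S) (M := X)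
  let f' : Fin n → (ModuleCat.restrictScalars.{u} φ).obj X := f
  refine ⟨Submodule.fg_def.2 ⟨Set.range f', Set.finite_range f', ?_⟩⟩
  rw [eq_top_iff]
  intro x _
  have hx : (show X from x) ∈ Submodule.span S (Set.range f) := by rw [hf]; trivial
  refine Submodule.span_induction (p := fun (y : X) _ =>
    (show (ModuleCat.restrictScalars.{u} φ).obj X from y) ∈ Submodule.span R (Set.range f'))
    (fun y hy => Submodule.subset_span hy) (Submodule.zero_mem _)
    (fun y z _ _ hy hz => Submodule.add_mem _ hy hz) (fun s y _ hy => ?_) hx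
  obtain ⟨r, rfl⟩ := hφ s
  exact Submodule.smul_mem _ r hy

end Restriction

/-! ### Paths of modules and their translation into the abstract theory. -/

section Paths

variable {A : Type u} [Ring A]

lemma IsPath.mem_left {M N : RightMod A} {s : ℕ} (h : IsPath M N s) : M ∈ ind A := by
  cases h <;> assumption

lemma IsPath.mem_right {M N : RightMod A} {s : ℕ} (h : IsPath M N s) : N ∈ ind A := by
  induction h with
  | nil h => exact h
  | cons _ _ _ _ _ ih => exact ih

lemma IsPath.trans {M N P : RightMod A} {s t : ℕ} (h : IsPath M N s) (h' : IsPath N P t) :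
    IsPath M P (s + t) := by
  induction h with
  | nil _ => rwa [zero_add]
  | cons hX f hf hf' _ ih =>
    rw [Nat.add_right_comm]
    exact .cons hX f hf hf' (ih h')

end Paths

section Comparison

variable {k : Type*} [Field k] {A : Type u} [Ring A] [Algebra k A] [FiniteDimensional k A]

lemma mem_ind_iff {X : RightMod A} : X ∈ ind A ↔ (moduleTheory k).Ind X :=
  and_congr Iff.rfl isIndec_iff_indecomposable.symm

lemma IsPath.exists_seq {M N : RightMod A} {s : ℕ} (h : IsPath M N s) :
    ∃ X : ℕ → RightMod A, X 0 = M ∧ X s = N ∧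
      ∀ i < s, (moduleTheory k).Step (X i) (X (i + 1)) := by
  induction h with
  | @nil X _ => exact ⟨fun _ => X, rfl, rfl, fun i hi => by omega⟩
  | @cons X Y Z s hX f hf hf' hp ih =>
    obtain ⟨V, h0, h1, h2⟩ := ih
    refine ⟨fun i => Nat.casesOn i X V, rfl, h1, fun i hi => ?_⟩
    cases i with
    | zero =>
      subst h0
      exact ⟨mem_ind_iff.1 hX, mem_ind_iff.1 hp.mem_left, f, hf, hf'⟩
    | succ i => exact h2 i (by omega)

lemma isPath_of_step {X Y Z : RightMod A} {s : ℕ} (h : (moduleTheory k).Step X Y)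
    (h' : IsPath Y Z s) : IsPath X Z (s + 1) := by
  obtain ⟨hX, -, f, hf, hf'⟩ := h
  exact .cons (mem_ind_iff.2 hX) f hf hf' h'

lemma isPath_of_seq {X : ℕ → RightMod A} {i : ℕ} (n : ℕ) (hi : X (i + n) ∈ ind A)
    (hX : ∀ j < n, (moduleTheory k).Step (X (i + j)) (X (i + j + 1))) :
    IsPath (X i) (X (i + n)) n := by
  induction n generalizing i with
  | zero => exact .nil hi
  | succ n ih =>
    have hin : i + 1 + n = i + (n + 1) := by omega
    rw [← hin] at hi ⊢
    refine isPath_of_step (hX 0 (by omega)) (ih hi fun j hj => ?_)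
    rw [show i + 1 + j = i + (j + 1) by omega]
    exact hX (j + 1) (by omega)

lemma exists_isPath_iff {X Y : RightMod A} (hY : Y ∈ ind A) :
    (∃ s, IsPath X Y s) ↔ ReflTransGen (moduleTheory k).Step X Y := by
  constructor
  · rintro ⟨s, h⟩
    induction h with
    | nil _ => exact .refl
    | cons hX f hf hf' hp ih =>
      exact (ih hY).head ⟨mem_ind_iff.1 hX, mem_ind_iff.1 hp.mem_left, f, hf, hf'⟩
  · intro h
    induction h using ReflTransGen.head_induction_on with
    | refl => exact ⟨0, .nil hY⟩
    | head h _ ih =>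
      obtain ⟨s, hs⟩ := ih
      exact ⟨s + 1, isPath_of_step h hs⟩

lemma pdLEOne_iff {X : RightMod A} (hX : X ∈ ind A) :
    (moduleTheory k).PdLEOne X ↔ HasProjectiveDimensionLE X 1 := by
  constructor
  · intro h
    obtain ⟨Q, p, hQ, hQ', hp⟩ := (moduleTheory k).exists_projective (mem_ind_iff.1 hX).1
    have hS := shortExact_kernel p
    refine (hS.hasProjectiveDimensionLT_X₃_iff 0 hQ').2 ?_
    rw [← projective_iff_hasProjectiveDimensionLT_one]
    exact h _ _ _ hS hQ hQ'
  · intro h K Q i p w hS hQ hQ'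
    rw [projective_iff_hasProjectiveDimensionLT_one]
    exact (hS.hasProjectiveDimensionLT_X₃_iff 0 hQ').1 h

lemma idLEOne_iff {X : RightMod A} (hX : X ∈ ind A) :
    (moduleTheory k).IdLEOne X ↔ HasInjectiveDimensionLE X 1 := by
  constructor
  · intro h
    obtain ⟨Q, p, hQ, hQ', hp⟩ := (moduleTheory k).exists_injective (mem_ind_iff.1 hX).1
    have hS := shortExact_cokernel p
    refine (hS.hasInjectiveDimensionLT_X₃_iff 0 hQ').1 ?_
    rw [← injective_iff_hasInjectiveDimensionLT_one]
    exact h _ _ _ hS hQ hQ'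
  · intro h Q K i p w hS hQ hQ'
    rw [injective_iff_hasInjectiveDimensionLT_one]
    exact (hS.hasInjectiveDimensionLT_X₃_iff 0 hQ').2 h

lemma left_of_mem_leftPart {X : RightMod A} (h : X ∈ leftPart A) : (moduleTheory k).Left X :=
  ⟨mem_ind_iff.1 h.1, fun W hW => by
    obtain ⟨s, hs⟩ := (exists_isPath_iff h.1).2 hW
    exact (pdLEOne_iff hs.mem_left).2 (h.2 W s hs)⟩

lemma right_of_mem_rightPart {X : RightMod A} (h : X ∈ rightPart A) :
    (moduleTheory k).Right X :=
  ⟨mem_ind_iff.1 h.1, fun W hW => by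
    have hW' : W ∈ ind A := by
      rcases hW.cases_tail with rfl | ⟨V, -, hV⟩
      exacts [h.1, mem_ind_iff.2 hV.2.1]
    obtain ⟨s, hs⟩ := (exists_isPath_iff hW').2 hW
    exact (idLEOne_iff hW').2 (h.2 W s hs)⟩

lemma exists_injective_isPath (k : Type*) [Field k] {A : Type u} [Ring A] [Algebra k A]
    [FiniteDimensional k A] {X : RightMod A} (hX : X ∈ ind A) (h : X ∉ leftPart A) :
    ∃ J s, Injective J ∧ IsPath J X s := by
  have : ∃ W s, IsPath W X s ∧ ¬ HasProjectiveDimensionLE W 1 := by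
    by_contra! H
    exact h ⟨hX, H⟩
  obtain ⟨W, s, hs, hW⟩ := this
  obtain ⟨J, -, hJ, hp⟩ := FiniteTheory.exists_injective_path (T := moduleTheory k)
    (mem_ind_iff.1 hs.mem_left) fun h => hW ((pdLEOne_iff hs.mem_left).1 h)
  obtain ⟨t, ht⟩ := (exists_isPath_iff hs.mem_left).2 hp
  exact ⟨J, _, hJ, ht.trans hs⟩

lemma exists_isPath_projective (k : Type*) [Field k] {A : Type u} [Ring A] [Algebra k A]
    [FiniteDimensional k A] {X : RightMod A} (hX : X ∈ ind A) (h : X ∉ rightPart A) :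
    ∃ P s, Projective P ∧ IsPath X P s := by
  have : ∃ W s, IsPath X W s ∧ ¬ HasInjectiveDimensionLE W 1 := by
    by_contra! H
    exact h ⟨hX, H⟩
  obtain ⟨W, s, hs, hW⟩ := this
  obtain ⟨P, hP', hP, hp⟩ := FiniteTheory.exists_projective_path (T := moduleTheory k)
    (mem_ind_iff.1 hs.mem_right) fun h => hW ((idLEOne_iff hs.mem_right).1 h)
  obtain ⟨t, ht⟩ := (exists_isPath_iff (mem_ind_iff.2 hP')).2 hp
  exact ⟨P, _, hP, hs.trans ht⟩

end Comparison

/-! ### Descent to the quotient algebra. -/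

section Quotient

variable {A B : Type u} [Ring A] [Ring B] {φ : Aᵐᵒᵖ →+* Bᵐᵒᵖ}

lemma ind_restrictScalars (hφ : Function.Surjective φ) {X : RightMod B} (hX : X ∈ ind B) :
    (ModuleCat.restrictScalars.{u} φ).obj X ∈ ind A :=
  ⟨finite_restrictScalars hφ hX.1, isIndec_iff_indecomposable.1
    (isIndec_restrictScalars hφ (isIndec_iff_indecomposable.2 hX.2))⟩

lemma isPath_restrictScalars (hφ : Function.Surjective φ) {M N : RightMod B} {s : ℕ}
    (h : IsPath M N s) : IsPath ((ModuleCat.restrictScalars.{u} φ).obj M)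
      ((ModuleCat.restrictScalars.{u} φ).obj N) s := by
  induction h with
  | nil h => exact .nil (ind_restrictScalars hφ h)
  | cons hX f hf hf' _ ih =>
    refine .cons (ind_restrictScalars hφ hX) ((ModuleCat.restrictScalars.{u} φ).map f)
      (fun h0 => hf ?_) (fun h => hf' ?_) ih
    · exact (ModuleCat.restrictScalars.{u} φ).map_injective (by rw [h0, Functor.map_zero])
    · exact isIso_of_reflects_iso f (ModuleCat.restrictScalars.{u} φ)

lemma mem_leftPart_of_restrictScalars (hφ : Function.Surjective φ) (hJ : IdempotentKernel φ)
    {X : RightMod B} (hX : X ∈ ind B)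
    (h : (ModuleCat.restrictScalars.{u} φ).obj X ∈ leftPart A) : X ∈ leftPart B :=
  ⟨hX, fun W s hW => hasProjectiveDimensionLE_one_of_restrictScalars hφ hJ W
    (h.2 _ s (isPath_restrictScalars hφ hW))⟩

lemma mem_rightPart_of_restrictScalars (hφ : Function.Surjective φ) (hJ : IdempotentKernel φ)
    {X : RightMod B} (hX : X ∈ ind B)
    (h : (ModuleCat.restrictScalars.{u} φ).obj X ∈ rightPart A) : X ∈ rightPart B :=
  ⟨hX, fun W s hW => hasInjectiveDimensionLE_one_of_restrictScalars hφ hJ W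
    (h.2 _ s (isPath_restrictScalars hφ hW))⟩

lemma CofiniteInInd.of_restrictScalars (hφ : Function.Surjective φ) {U : Set (RightMod A)}
    {V : Set (RightMod B)} (hU : CofiniteInInd A U)
    (h : ∀ X ∈ ind B, (ModuleCat.restrictScalars.{u} φ).obj X ∈ U → X ∈ V) :
    CofiniteInInd B V := by
  have := full_restrictScalars hφ
  let Φ : Quotient (isIsomorphicSetoid (RightMod B)) → Quotient (isIsomorphicSetoid (RightMod A)) :=
    Quotient.map (ModuleCat.restrictScalars.{u} φ).obj
      fun _ _ ⟨e⟩ => ⟨(ModuleCat.restrictScalars.{u} φ).mapIso e⟩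
  have hΦ : Function.Injective Φ := by
    rintro ⟨X⟩ ⟨Y⟩ hXY
    obtain ⟨e⟩ := Quotient.exact hXY
    exact Quotient.sound ⟨(ModuleCat.restrictScalars.{u} φ).preimageIso e⟩
  refine Set.Finite.of_finite_image (f := Φ) (hU.subset ?_) hΦ.injOn
  rintro _ ⟨_, ⟨X, ⟨hX, hX'⟩, rfl⟩, rfl⟩
  exact ⟨_, ⟨ind_restrictScalars hφ hX, fun h' => hX' (h X hX h')⟩, rfl⟩

lemma IsWeaklyShod.of_restrictScalars (k : Type*) [Field k] [Algebra k A] [FiniteDimensional k A]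
    [Algebra k B] [FiniteDimensional k B] (hφ : Function.Surjective φ) (hJ : IdempotentKernel φ)
    (h : IsWeaklyShod A) : IsWeaklyShod B := by
  obtain ⟨l, hl⟩ := h
  let T : FiniteTheory (RightMod B) := moduleTheory k
  let F := ModuleCat.restrictScalars.{u} φ
  refine ⟨l + 2 * T.rank, fun I P m hI hP hp => ?_⟩
  obtain ⟨X, rfl, rfl, hX⟩ := hp.exists_seq (k := k)
  have hind : ∀ i ≤ m, X i ∈ ind B := fun i hi => by
    rcases hi.eq_or_lt with rfl | hi
    exacts [hp.mem_right, mem_ind_iff.2 (hX i hi).1]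
  rcases FiniteTheory.exists_middle (T := T) X (fun Y => F.obj Y ∈ leftPart A)
    (fun Y => F.obj Y ∈ rightPart A)
    (fun i hi h => left_of_mem_leftPart (mem_leftPart_of_restrictScalars hφ hJ (hind i hi) h))
    (fun i hi h => right_of_mem_rightPart (mem_rightPart_of_restrictScalars hφ hJ (hind i hi) h))
    hI hP hX with h | ⟨i, j, hij, hjm, hm, hi, hj⟩
  · omega
  -- The middle stretch of length `j - i` is prolonged over `A` at both ends. The hypothesis on `A`
  -- bounds the total length, hence `j - i`.
  · obtain ⟨J, s, hJ', hs⟩ :=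
      exists_injective_isPath k (ind_restrictScalars hφ (hind i (by omega))) hi
    obtain ⟨Q, t, hQ, ht⟩ := exists_isPath_projective k (ind_restrictScalars hφ (hind j hjm)) hj
    obtain ⟨n, rfl⟩ := Nat.exists_eq_add_of_le hij
    have hmid := isPath_of_seq (k := k) (X := X) n (hind _ hjm) fun a ha => hX _ (by omega)
    have := hl J Q _ hJ' hQ ((hs.trans (isPath_restrictScalars hφ hmid)).trans ht)
    omega

/-- The projection from `A` to `A / AeA`, on opposite rings. -/
def quotMap (e : A) : Aᵐᵒᵖ →+* (quotByIdeal e)ᵐᵒᵖ :=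
  RingHom.op (TwoSidedIdeal.span {e}).ringCon.mk'

lemma quotMap_surjective (e : A) : Function.Surjective (quotMap e) := fun x => by
  obtain ⟨a, ha⟩ := RingCon.mk'_surjective (TwoSidedIdeal.span {e}).ringCon x.unop
  exact ⟨MulOpposite.op a, MulOpposite.unop_injective ha⟩

lemma quotMap_eq_zero_iff (e : A) (x : Aᵐᵒᵖ) :
    quotMap e x = 0 ↔ x.unop ∈ TwoSidedIdeal.span {e} := by
  rw [← MulOpposite.unop_injective.eq_iff, TwoSidedIdeal.mem_iff]
  exact RingCon.eq _

open scoped Pointwise in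
lemma idempotentKernel_quotMap {e : A} (he : IsIdempotentElem e) :
    IdempotentKernel (quotMap e) := by
  intro j hj
  rw [quotMap_eq_zero_iff, TwoSidedIdeal.mem_span_iff_mem_addSubgroup_closure] at hj
  have hle : AddSubgroup.closure (Set.univ * {e} * Set.univ : Set A) ≤
      (AddSubgroup.closure {x | ∃ a b, quotMap e a = 0 ∧ quotMap e b = 0 ∧ x = a * b}).comap
        (MulOpposite.opAddEquiv (α := A)).toAddMonoidHom := by
    rw [AddSubgroup.closure_le]
    rintro _ ⟨_, ⟨a, -, y, hy, rfl⟩, b, -, rfl⟩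
    obtain rfl : e = y := hy.symm
    have hmem := TwoSidedIdeal.subset_span (Set.mem_singleton e)
    -- The factorisation is `a e b = (a e)(e b)`, with the factors swapped in the opposite ring.
    refine AddSubgroup.subset_closure ⟨.op (e * b), .op (a * e),
      (quotMap_eq_zero_iff e _).2 (TwoSidedIdeal.mul_mem_right _ _ _ hmem),
      (quotMap_eq_zero_iff e _).2 (TwoSidedIdeal.mul_mem_left _ _ _ hmem), ?_⟩
    apply MulOpposite.unop_injective
    change a * e * b = a * e * (e * b)
    rw [← mul_assoc, mul_assoc a e e, he.eq]
  exact hle hj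

end Quotient

end IdempotentQuotient

open IdempotentQuotient

theorem theorem4p1 {k : Type*} [Field k] {A : Type u} [Ring A] [Algebra k A]
    [FiniteDimensional k A] (e : A) (he : IsIdempotentElem e) :
    (IdempotentQuotient.IsLaura A →
      IdempotentQuotient.IsLaura (IdempotentQuotient.quotByIdeal e)) ∧
    (IdempotentQuotient.IsRightGlued A →
      IdempotentQuotient.IsRightGlued (IdempotentQuotient.quotByIdeal e)) ∧
    (IdempotentQuotient.IsLeftGlued A →
      IdempotentQuotient.IsLeftGlued (IdempotentQuotient.quotByIdeal e)) ∧
    (IdempotentQuotient.IsWeaklyShod A →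
      IdempotentQuotient.IsWeaklyShod (IdempotentQuotient.quotByIdeal e)) ∧
    (IdempotentQuotient.IsShod A →
      IdempotentQuotient.IsShod (IdempotentQuotient.quotByIdeal e)) := by
  have hφ := quotMap_surjective e
  have hJ := idempotentKernel_quotMap he
  have hL := fun X hX => mem_leftPart_of_restrictScalars hφ hJ (X := X) hX
  have hR := fun X hX => mem_rightPart_of_restrictScalars hφ hJ (X := X) hX
  refine ⟨fun h => h.of_restrictScalars hφ fun X hX => Or.imp (hL X hX) (hR X hX),
    fun h => h.of_restrictScalars hφ hL, fun h => h.of_restrictScalars hφ hR, fun h => ?_,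
    fun h M hM => ?_⟩
  · have : FiniteDimensional k (quotByIdeal e) :=
      Module.Finite.of_surjective (M := A) (σ := RingHom.id k)
        { (TwoSidedIdeal.span {e}).ringCon.mk' with map_smul' := fun _ _ => rfl }
        (RingCon.mk'_surjective _)
    exact h.of_restrictScalars k hφ hJ
  · exact (h _ (ind_restrictScalars hφ hM)).imp
      (hasProjectiveDimensionLE_one_of_restrictScalars hφ hJ M)
      (hasInjectiveDimensionLE_one_of_restrictScalars hφ hJ M)
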